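/- For $x>0$ let $\rho(x)=\log(1+1/x)-\frac1{1+x}$ and $g(x)=-\rho'(x)/\rho(x)$, and for $a>0$ let $h_a(x)=(1+1/x)^{ax}$. A function $f:(0,\infty)\to\mathbb R$ is a Stieltjes function if $f(x)=c+\int_{[0,\infty)}\frac{d\sigma(t)}{t+x}$ for all $x>0$, for some $c\ge 0$ and some positive Radon measure $\sigma$ on $[0,\infty)$ making the integral converge. It is completely monotonic if it is $C^\infty$ and $(-1)^nf^{(n)}(x)\ge 0$ for all $n\ge 0$ and $x>0$. A positive $C^\infty$-function $f$ on $(0,\infty)$ is logarithmically completely monotonic ($f\in\mathrm{LCM}$) if $-f'/f$ is completely monotonic. Then $g$ is a Stieltjes function. It has a holomorphic extension $G$ to $\mathbb C\setminus(-\infty,0]$, and for every $t\in(0,1)$ the boundary value $$\tau(t)=-\frac1\pi\lim_{y\to0^+}\operatorname{Im}G(-t+iy)$$ exists and is positive. The function $\tau$ is integrable on $(0,1)$ with $\int_0^1\tau(t)\,dt=1$, and $$g(x)=\frac1{1+x}+\int_0^1\frac{\tau(t)}{x+t}\,dt,\qquad x>0.$$ Moreover, with $t_n=\int_0^1 s^n\,\tau(1-s)\,ds$,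 for every $a>0$ the series below converges for all $t\ge0$, and $$h_a'\in\mathrm{LCM}\iff 2+\sum_{n=1}^\infty\Bigl(t_n-\frac a{n+1}\Bigr)\frac{t^n}{n!}\ \ge\ 0\quad\text{for all }t\ge0 .$$ -/

import Mathlib

open Set Filter Topology MeasureTheory
open scoped ContDiff Nat

noncomputable section

/-- Stieltjes functions (class `S`): on `(0,∞)`, `f(x) = c + ∫_{[0,∞)} dσ(t) / (t + x)` with `c ≥ 0`
and `σ` a positive Radon measure on `[0,∞)` for which the integral converges. A Radon measure on
`[0,∞)` is given as a locally finite Borel measure on `ℝ` without mass on `(-∞,0)`. -/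
def IsStieltjes (f : ℝ → ℝ) : Prop :=
  ∃ (c : ℝ) (σ : Measure ℝ), 0 ≤ c ∧ IsLocallyFiniteMeasure σ ∧ σ (Iio 0) = 0 ∧
    ∀ x : ℝ, 0 < x →
      Integrable (fun t : ℝ => 1 / (t + x)) σ ∧ f x = c + ∫ t, 1 / (t + x) ∂σ

/-- Completely monotonic functions (class `CM`) on `(0,∞)`. -/
def IsCM (f : ℝ → ℝ) : Prop :=
  ContDiffOn ℝ ∞ f (Ioi 0) ∧
    ∀ (n : ℕ) (x : ℝ), 0 < x → 0 ≤ (-1 : ℝ) ^ n * iteratedDeriv n f x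

/-- Logarithmically completely monotonic functions (class `LCM`) on `(0,∞)`: positive smooth
functions `f` for which `-f'/f = -(log f)'` is completely monotonic. -/
def IsLCM (f : ℝ → ℝ) : Prop :=
  ContDiffOn ℝ ∞ f (Ioi 0) ∧ (∀ x : ℝ, 0 < x → 0 < f x) ∧
    IsCM (fun x => -deriv f x / f x)

/-- `ρ(x) = log(1 + 1/x) - 1/(1 + x)` for `x > 0`. -/
def rho (x : ℝ) : ℝ := Real.log (1 + 1 / x) - 1 / (1 + x)

/-- `g = -ρ'/ρ` on `(0,∞)`. -/
def gFun (x : ℝ) : ℝ := -deriv rho x / rho x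

/-- `h_a(x) = (1 + 1/x)^{a x}` for `x > 0`. -/
def hFun (a x : ℝ) : ℝ := (1 + 1 / x) ^ (a * x)

/-- `t_n`, the `n`-th moment of the measure `τ(1 - s) ds` on `(0,1)`. -/
def moment (τ : ℝ → ℝ) (n : ℕ) : ℝ := ∫ s in (0 : ℝ)..1, s ^ n * τ (1 - s)

/-- The `n`-th term of the power series `∑ (t_n - a/(n+1)) t^n / n!`. -/
def seriesTerm (τ : ℝ → ℝ) (a t : ℝ) (n : ℕ) : ℝ :=
  (moment τ n - a / ((n : ℝ) + 1)) * t ^ n / (n ! : ℝ)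

end

/-! ### Real-variable facts on `rho`, `gFun` and the density -/

/-! Put `w = log (1 + 1/z)`, so that `1/(1 + z) = 1 - e⁻ʷ` and `ρ` becomes the entire function
`rhoStrip w = w - 1 + e⁻ʷ`. The complement of the cut `[-1, 0]`, with `z = ∞` added, corresponds to
the strip `|Im w| < π`; the two sides of `(-1, 0)` become the lines `Im w = ±π`, and `z → -1`, `z →
0` become `Re w → -∞`, `Re w → +∞`. On the closed strip `rhoStrip` vanishes only at `w = 0`, and
doubly there (`rhoStrip_ne_zero`, `rhoStripQuot_ne_zero`). Hence `G` is holomorphic on the slit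
plane, and the form `G(z) dz / (z - x)` has in the closed strip only a simple pole at `stripPoint
x`, with residue `g(x)`.

Cauchy's theorem on growing rectangles gives the integral representation (`gFun_eq_integral`): the
horizontal sides produce the density `τ`, the left side the atom `1/(1 + x)`, the right side
nothing. The mass of `τ` is computed separately, from an explicit arctangent primitive.

Since `h_a' = a h_a ρ` and `h_a'/h_a = a ρ`, one has `-h_a''/h_a' = g - a ρ`. With `ρ` written as a
difference of Stieltjes kernels, this is the Laplace transform of `laplaceDensity a`. It is
completely monotonic exactly when that density is nonnegative (`isCM_laplace_iff`), and the density
equals `e⁻ˢ` times the power series of the theorem (`laplaceDensity_eq`). -/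

theorem rho_eq_log_sub_log {x : ℝ} (hx : 0 < x) :
    rho x = Real.log (1 + x) - Real.log x - 1 / (1 + x) := by
  have : 1 + 1 / x = (1 + x) / x := by field_simp; ring
  rw [rho, this, Real.log_div (by positivity) hx.ne']

theorem hasDerivAt_rho {x : ℝ} (hx : 0 < x) :
    HasDerivAt rho (-(1 / (x * (1 + x) ^ 2))) x := by
  have h1 : HasDerivAt (fun y : ℝ => 1 + y) 1 x := (hasDerivAt_id x).const_add 1
  have hx1 : 1 + x ≠ 0 := by positivity
  have h : HasDerivAt (fun y : ℝ => Real.log (1 + y) - Real.log y - 1 / (1 + y))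
      (-(1 / (x * (1 + x) ^ 2))) x := by
    have := ((h1.log hx1).sub (Real.hasDerivAt_log hx.ne')).sub
      ((hasDerivAt_const x (1 : ℝ)).div h1 hx1)
    convert! this using 1
    have := hx.ne'
    field_simp
    ring
  refine h.congr_of_eventuallyEq ?_
  filter_upwards [Ioi_mem_nhds hx] with y hy using rho_eq_log_sub_log hy

theorem rho_pos {x : ℝ} (hx : 0 < x) : 0 < rho x := by
  have h2 : Real.log (x / (1 + x)) < x / (1 + x) - 1 := by
    refine Real.log_lt_sub_one_of_pos (by positivity) ?_
    intro h
    rw [div_eq_one_iff_eq (by positivity)] at h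
    linarith
  rw [rho_eq_log_sub_log hx]
  rw [Real.log_div hx.ne' (by positivity)] at h2
  have : x / (1 + x) - 1 = - (1 / (1 + x)) := by field_simp; ring
  linarith

theorem gFun_eq {x : ℝ} (hx : 0 < x) : gFun x = 1 / (x * (1 + x) ^ 2 * rho x) := by
  have := (rho_pos hx).ne'
  rw [gFun, (hasDerivAt_rho hx).deriv]
  field_simp

/-- The real part of the boundary value of `ρ` at the point `-t` of the cut. -/
noncomputable def rhoCutRe (t : ℝ) : ℝ := Real.log (1 - t) - Real.log t - 1 / (1 - t)

/-- The density of the Stieltjes measure of `gFun` on `(0,1)`. -/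
noncomputable def gDensity (t : ℝ) : ℝ :=
  1 / (t * (1 - t) ^ 2 * (rhoCutRe t ^ 2 + Real.pi ^ 2))

theorem gDensity_pos {t : ℝ} (ht : t ∈ Ioo (0 : ℝ) 1) : 0 < gDensity t := by
  have h0 := ht.1
  have h1 : 0 < 1 - t := by linarith [ht.2]
  have := Real.pi_pos
  unfold gDensity
  positivity

theorem measurable_gDensity : Measurable gDensity := by
  unfold gDensity rhoCutRe
  fun_prop

theorem hasDerivAt_rhoCutRe {t : ℝ} (ht : t ∈ Ioo (0 : ℝ) 1) :
    HasDerivAt rhoCutRe (-(1 / (t * (1 - t) ^ 2))) t := by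
  have h0 := ht.1.ne'
  have h1 : 1 - t ≠ 0 := by linarith [ht.2]
  have h : HasDerivAt (fun y : ℝ => 1 - y) (-1) t := (hasDerivAt_id t).const_sub 1
  have := ((h.log h1).sub (Real.hasDerivAt_log h0)).sub ((hasDerivAt_const t (1 : ℝ)).div h h1)
  convert! this using 1
  field_simp
  ring

/-- The factor `1 / (t (1 - t)²)` in the density is `-rhoCutRe'`, which makes the density an exact
arctangent derivative. -/
theorem hasDerivAt_gDensity_primitive {t : ℝ} (ht : t ∈ Ioo (0 : ℝ) 1) :
    HasDerivAt (fun t => -(1 / Real.pi) * Real.arctan (rhoCutRe t / Real.pi)) (gDensity t) t := by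
  have h0 := ht.1.ne'
  have h1 : 1 - t ≠ 0 := by linarith [ht.2]
  have hpi := Real.pi_pos.ne'
  have := (((hasDerivAt_rhoCutRe ht).div_const Real.pi).arctan).const_mul (-(1 / Real.pi))
  convert! this using 1
  unfold gDensity
  have : rhoCutRe t ^ 2 + Real.pi ^ 2 ≠ 0 := by positivity
  have h' : 1 + (rhoCutRe t / Real.pi) ^ 2 ≠ 0 := by positivity
  field_simp
  ring

theorem tendsto_rhoCutRe_zero : Tendsto rhoCutRe (𝓝[>] 0) atTop := by
  have h1 : Tendsto (fun t : ℝ => Real.log (1 - t) - 1 / (1 - t)) (𝓝[>] 0)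
      (𝓝 (Real.log (1 - 0) - 1 / (1 - 0))) := by
    refine Tendsto.mono_left ?_ nhdsWithin_le_nhds
    have : ContinuousAt (fun t : ℝ => Real.log (1 - t) - 1 / (1 - t)) 0 := by
      fun_prop (disch := norm_num)
    exact this
  have h2 : Tendsto (fun t : ℝ => -Real.log t) (𝓝[>] 0) atTop :=
    tendsto_neg_atBot_atTop.comp Real.tendsto_log_nhdsGT_zero
  refine (h1.add_atTop h2).congr fun t => ?_
  unfold rhoCutRe
  ring

theorem tendsto_rhoCutRe_one : Tendsto rhoCutRe (𝓝[<] 1) atBot := by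
  have hs : Tendsto (fun t : ℝ => 1 - t) (𝓝[<] 1) (𝓝[>] 0) := by
    refine tendsto_nhdsWithin_iff.2 ⟨?_, ?_⟩
    · refine Tendsto.mono_left ?_ nhdsWithin_le_nhds
      have : ContinuousAt (fun t : ℝ => 1 - t) 1 := by fun_prop
      simpa [ContinuousAt] using this
    · filter_upwards [self_mem_nhdsWithin] with t ht
      simpa using ht
  have h1 : Tendsto (fun t : ℝ => Real.log (1 - t)) (𝓝[<] 1) atBot :=
    Real.tendsto_log_nhdsGT_zero.comp hs
  have h2 : Tendsto (fun t : ℝ => -(1 / (1 - t))) (𝓝[<] 1) atBot := by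
    refine tendsto_neg_atTop_atBot.comp ?_
    simpa [Function.comp_def] using tendsto_inv_nhdsGT_zero.comp hs
  have h3 : Tendsto (fun t : ℝ => -Real.log t) (𝓝[<] 1) (𝓝 (-Real.log 1)) := by
    refine Tendsto.mono_left ?_ nhdsWithin_le_nhds
    have : ContinuousAt (fun t : ℝ => -Real.log t) 1 := by fun_prop (disch := norm_num)
    exact this
  refine ((h1.atBot_add_atBot h2).atBot_add h3).congr fun t => ?_
  unfold rhoCutRe
  ring

theorem tendsto_gDensity_primitive_zero :
    Tendsto (fun t => -(1 / Real.pi) * Real.arctan (rhoCutRe t / Real.pi)) (𝓝[>] 0)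
      (𝓝 (-(1 / 2))) := by
  have h := (tendsto_nhds_of_tendsto_nhdsWithin Real.tendsto_arctan_atTop).comp
    (tendsto_rhoCutRe_zero.atTop_div_const Real.pi_pos)
  convert! h.const_mul (-(1 / Real.pi)) using 2
  have := Real.pi_pos.ne'
  field_simp

theorem tendsto_gDensity_primitive_one :
    Tendsto (fun t => -(1 / Real.pi) * Real.arctan (rhoCutRe t / Real.pi)) (𝓝[<] 1)
      (𝓝 (1 / 2)) := by
  have h := (tendsto_nhds_of_tendsto_nhdsWithin Real.tendsto_arctan_atBot).comp
    (tendsto_rhoCutRe_one.atBot_div_const Real.pi_pos)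
  convert! h.const_mul (-(1 / Real.pi)) using 2
  have := Real.pi_pos.ne'
  field_simp

/-- No estimate at the endpoints is needed: a nonnegative derivative of a function that extends
continuously to `[0, 1]` is integrable. -/
theorem intervalIntegrable_gDensity : IntervalIntegrable gDensity volume 0 1 := by
  set T := fun t => -(1 / Real.pi) * Real.arctan (rhoCutRe t / Real.pi) with hT
  have hc : ContinuousOn T (Ioo 0 1) := fun t ht =>
    (hasDerivAt_gDensity_primitive ht).continuousAt.continuousWithinAt
  have hext := continuousOn_Icc_extendFrom_Ioo hc
    tendsto_gDensity_primitive_zero tendsto_gDensity_primitive_one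
  refine intervalIntegral.intervalIntegrable_deriv_of_nonneg (g := extendFrom (Ioo 0 1) T)
    (by rwa [uIcc_of_le zero_le_one]) ?_ ?_
  · simp only [min_eq_left zero_le_one, max_eq_right (zero_le_one (α := ℝ))]
    intro t ht
    refine (hasDerivAt_gDensity_primitive ht).congr_of_eventuallyEq ?_
    filter_upwards [Ioo_mem_nhds ht.1 ht.2] with s hs
    exact extendFrom_extends hc s hs
  · simp only [min_eq_left zero_le_one, max_eq_right (zero_le_one (α := ℝ))]
    exact fun t ht => (gDensity_pos ht).le

theorem integral_gDensity : (∫ t in (0 : ℝ)..1, gDensity t) = 1 := by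
  rw [intervalIntegral.integral_eq_sub_of_hasDerivAt_of_tendsto zero_lt_one
    (fun t ht => hasDerivAt_gDensity_primitive ht) intervalIntegrable_gDensity
    tendsto_gDensity_primitive_zero tendsto_gDensity_primitive_one]
  norm_num

/-! ### The holomorphic extension of `gFun` -/

theorem mul_cos_le_sin {v : ℝ} (h0 : 0 < v) (hv : v ≤ Real.pi) : v * Real.cos v ≤ Real.sin v := by
  have hs := Real.sin_nonneg_of_nonneg_of_le_pi h0.le hv
  rcases le_or_gt (Real.cos v) 0 with hc | hc
  · nlinarith
  · have hv2 : v < Real.pi / 2 := by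
      by_contra! h
      exact absurd (Real.cos_nonpos_of_pi_div_two_le_of_le h (by linarith [Real.pi_pos])) hc.not_ge
    have := (Real.lt_tan h0 hv2).le
    rwa [Real.tan_eq_sin_div_cos, le_div_iff₀ hc] at this

/-- If both parts vanished, `v = e⁻ᵘ sin v` together with `sin v < v` would force `sin v > 0` and `u
< 0`. Eliminating `e⁻ᵘ` gives `(1 - u) sin v = v cos v`, which contradicts `v cos v ≤ sin v < (1 -
u) sin v`. -/
theorem exp_neg_cos_sin_system_inconsistent {u v : ℝ} (h0 : 0 < v) (hv : v ≤ Real.pi)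
    (hre : u - 1 + Real.exp (-u) * Real.cos v = 0) : v - Real.exp (-u) * Real.sin v ≠ 0 := by
  intro him
  have he := Real.exp_pos (-u)
  have hs : 0 < Real.sin v := by
    by_contra! h
    nlinarith
  have h1 : 1 < Real.exp (-u) := by
    by_contra! h
    nlinarith [Real.sin_lt h0]
  have hu : u < 0 := by
    rw [Real.one_lt_exp_iff] at h1
    linarith
  have hmc := mul_cos_le_sin h0 hv
  have : (1 - u) * Real.sin v = v * Real.cos v := by
    linear_combination -Real.cos v * him - Real.sin v * hre
  nlinarith

/-- `w - 1 + e⁻ʷ`, which is `ρ` in the coordinate `w = log (1 + 1/z)`. -/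
noncomputable def rhoStrip (w : ℂ) : ℂ := w - 1 + Complex.exp (-w)

theorem rhoStrip_re (w : ℂ) :
    (rhoStrip w).re = w.re - 1 + Real.exp (-w.re) * Real.cos w.im := by
  simp [rhoStrip, Complex.exp_re]

theorem rhoStrip_im (w : ℂ) : (rhoStrip w).im = w.im - Real.exp (-w.re) * Real.sin w.im := by
  simp [rhoStrip, Complex.exp_im, sub_eq_add_neg]

theorem rhoStrip_ne_zero {w : ℂ} (hw : |w.im| ≤ Real.pi) (h0 : w ≠ 0) : rhoStrip w ≠ 0 := by
  intro h
  have hre := congrArg Complex.re h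
  have him := congrArg Complex.im h
  rw [rhoStrip_re, Complex.zero_re] at hre
  rw [rhoStrip_im, Complex.zero_im] at him
  rcases lt_trichotomy w.im 0 with hv | hv | hv
  · refine exp_neg_cos_sin_system_inconsistent (v := -w.im) (u := w.re) (by linarith)
      (by linarith [neg_abs_le w.im]) (by rwa [Real.cos_neg]) ?_
    rw [Real.sin_neg]
    linarith
  · rw [hv, Real.cos_zero, mul_one] at hre
    have hu : w.re ≠ 0 := fun hu => h0 (Complex.ext hu hv)
    have := Real.add_one_lt_exp (neg_ne_zero.2 hu)
    linarith
  · exact exp_neg_cos_sin_system_inconsistent hv (by linarith [le_abs_self w.im]) hre him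

/-- The holomorphic extension of `gFun` to the slit plane. -/
noncomputable def gExt (z : ℂ) : ℂ :=
  1 / (z * (1 + z) ^ 2 * (Complex.log (1 + 1 / z) - 1 / (1 + z)))

theorem one_add_ne_zero_of_mem_slitPlane {z : ℂ} (hz : z ∈ Complex.slitPlane) : 1 + z ≠ 0 := by
  intro h
  have : z = ((-1 : ℝ) : ℂ) := by push_cast; linear_combination h
  rw [this, Complex.ofReal_mem_slitPlane] at hz
  norm_num at hz

theorem one_add_one_div_mem_slitPlane {z : ℂ} (hz : z ∈ Complex.slitPlane) :
    1 + 1 / z ∈ Complex.slitPlane := by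
  rw [Complex.mem_slitPlane_iff_not_le_zero]
  intro h
  rw [Complex.le_def] at h
  have hq : 1 / z = (((1 + 1 / z).re - 1 : ℝ) : ℂ) := by
    refine Complex.ext (by simp) ?_
    have := h.2
    simp only [Complex.add_im, Complex.one_im, zero_add, Complex.zero_im] at this
    rw [this, Complex.ofReal_im]
  have hz' : z = ((((1 + 1 / z).re - 1)⁻¹ : ℝ) : ℂ) := by
    rw [Complex.ofReal_inv, ← hq, one_div, inv_inv]
  rw [hz', Complex.ofReal_mem_slitPlane, inv_pos] at hz
  have := h.1
  rw [Complex.zero_re] at this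
  linarith

theorem log_sub_one_div_eq_rhoStrip {z : ℂ} (hz : z ≠ 0) (hz1 : 1 + z ≠ 0) :
    Complex.log (1 + 1 / z) - 1 / (1 + z) = rhoStrip (Complex.log (1 + 1 / z)) := by
  have h : 1 + 1 / z = (1 + z) / z := by field_simp; ring
  have hne : 1 + 1 / z ≠ 0 := by rw [h]; exact div_ne_zero hz1 hz
  rw [rhoStrip, Complex.exp_neg, Complex.exp_log hne, h]
  field_simp
  ring

theorem log_sub_one_div_ne_zero {z : ℂ} (hz : z ∈ Complex.slitPlane) :
    Complex.log (1 + 1 / z) - 1 / (1 + z) ≠ 0 := by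
  have hz0 := Complex.slitPlane_ne_zero hz
  have hz1 := one_add_ne_zero_of_mem_slitPlane hz
  rw [log_sub_one_div_eq_rhoStrip hz0 hz1]
  refine rhoStrip_ne_zero ?_ ?_
  · rw [Complex.log_im]
    exact Complex.abs_arg_le_pi _
  · intro h
    have := Complex.exp_log (Complex.slitPlane_ne_zero (one_add_one_div_mem_slitPlane hz))
    rw [h, Complex.exp_zero] at this
    have h' : 1 / z = 0 := by linear_combination -this
    simp [hz0] at h'

theorem differentiableOn_gExt : DifferentiableOn ℂ gExt Complex.slitPlane := by
  intro z hz
  have hz0 := Complex.slitPlane_ne_zero hz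
  have hz1 := one_add_ne_zero_of_mem_slitPlane hz
  have h1 : DifferentiableAt ℂ (fun z : ℂ => 1 + 1 / z) z := by fun_prop (disch := assumption)
  have hl := h1.clog (one_add_one_div_mem_slitPlane hz)
  have h2 : DifferentiableAt ℂ (fun z : ℂ => 1 / (1 + z)) z := by fun_prop (disch := assumption)
  have h3 : DifferentiableAt ℂ (fun z : ℂ => z * (1 + z) ^ 2) z := by fun_prop
  refine DifferentiableAt.differentiableWithinAt ?_
  exact (differentiableAt_const (1 : ℂ)).div (h3.mul (hl.sub h2))
    (mul_ne_zero (mul_ne_zero hz0 (pow_ne_zero 2 hz1)) (log_sub_one_div_ne_zero hz))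

theorem gExt_ofReal {x : ℝ} (hx : 0 < x) : gExt x = (gFun x : ℂ) := by
  rw [gFun_eq hx, gExt, rho]
  have : (1 + 1 / (x : ℂ)) = ((1 + 1 / x : ℝ) : ℂ) := by push_cast; rfl
  rw [this, ← Complex.ofReal_log (by positivity)]
  push_cast
  rfl

/-- When `z` approaches `-t` from above, `1 + 1/z` approaches the negative number `-(1 - t)/t` from
below, so the logarithm tends to `log ((1 - t)/t) - πi`. -/
theorem gExt_boundary_value {t : ℝ} (ht : t ∈ Ioo (0 : ℝ) 1) :
    Tendsto (fun y : ℝ => gExt ((-t : ℂ) + (y : ℂ) * Complex.I)) (𝓝[>] (0 : ℝ))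
      (𝓝 (1 / ((-t : ℂ) * (1 + (-t : ℂ)) ^ 2 *
        ((rhoCutRe t : ℂ) - Real.pi * Complex.I)))) := by
  have ht0 := ht.1
  have ht1 : 0 < 1 - t := by linarith [ht.2]
  have hpi := Real.pi_pos
  have hz : Tendsto (fun y : ℝ => (-t : ℂ) + (y : ℂ) * Complex.I) (𝓝[>] (0 : ℝ)) (𝓝 (-t)) := by
    refine Tendsto.mono_left ?_ nhdsWithin_le_nhds
    have : ContinuousAt (fun y : ℝ => (-t : ℂ) + (y : ℂ) * Complex.I) 0 := by fun_prop
    simpa [ContinuousAt] using this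
  have htC : (-t : ℂ) ≠ 0 := by simpa using ht0.ne'
  have ht1C : (1 + (-t : ℂ)) ≠ 0 := by
    rw [← sub_eq_add_neg]
    exact_mod_cast ht1.ne'
  have hq : (1 + 1 / (-t : ℂ)) = ((-((1 - t) / t) : ℝ) : ℂ) := by
    push_cast
    have : (t : ℂ) ≠ 0 := by exact_mod_cast ht0.ne'
    field_simp
    ring
  have hqneg : -((1 - t) / t) < 0 := by
    have : 0 < (1 - t) / t := by positivity
    linarith
  have hlog : Tendsto (fun y : ℝ => Complex.log (1 + 1 / ((-t : ℂ) + (y : ℂ) * Complex.I)))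
      (𝓝[>] (0 : ℝ)) (𝓝 (Real.log ((1 - t) / t) - Real.pi * Complex.I)) := by
    have h := Complex.tendsto_log_nhdsWithin_im_neg_of_re_neg_of_im_zero
      (z := ((-((1 - t) / t) : ℝ) : ℂ)) (by simpa using hqneg) (Complex.ofReal_im _)
    rw [Complex.norm_real, norm_neg, Real.norm_of_nonneg (by positivity)] at h
    refine h.comp (tendsto_nhdsWithin_iff.2 ⟨?_, ?_⟩)
    · rw [← hq]
      exact tendsto_const_nhds.add (tendsto_const_nhds.div hz htC)
    · filter_upwards [self_mem_nhdsWithin] with y hy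
      have hy : 0 < y := hy
      have hn : 0 < Complex.normSq ((-t : ℂ) + (y : ℂ) * Complex.I) := by
        rw [Complex.normSq_pos]
        intro h
        have := congrArg Complex.im h
        simp at this
        exact hy.ne' this
      simp only [one_div, Complex.add_im, Complex.one_im, Complex.inv_im, zero_add]
      refine div_neg_of_neg_of_pos ?_ hn
      simpa using hy
  have hlim : (rhoCutRe t : ℂ) - Real.pi * Complex.I =
      (Real.log ((1 - t) / t) - Real.pi * Complex.I) - 1 / (1 + (-t : ℂ)) := by
    rw [rhoCutRe, Real.log_div ht1.ne' ht0.ne']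
    push_cast
    ring
  rw [hlim]
  refine tendsto_const_nhds.div ((hz.mul ((tendsto_const_nhds.add hz).pow 2)).mul
    (hlog.sub (tendsto_const_nhds.div (tendsto_const_nhds.add hz) ht1C))) ?_
  refine mul_ne_zero (mul_ne_zero htC (pow_ne_zero 2 ht1C)) ?_
  rw [← hlim]
  intro h
  have := congrArg Complex.im h
  simp at this

theorem tendsto_im_gExt {t : ℝ} (ht : t ∈ Ioo (0 : ℝ) 1) :
    Tendsto (fun y : ℝ => -(1 / Real.pi) * (gExt ((-t : ℂ) + (y : ℂ) * Complex.I)).im)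
      (𝓝[>] (0 : ℝ)) (𝓝 (gDensity t)) := by
  have h := ((Complex.continuous_im.tendsto _).comp (gExt_boundary_value ht)).const_mul
    (-(1 / Real.pi))
  convert! h using 2
  have ht0 := ht.1.ne'
  have ht1 : 1 - t ≠ 0 := by linarith [ht.2]
  have hpi := Real.pi_pos.ne'
  have e : (1 / ((-t : ℂ) * (1 + (-t : ℂ)) ^ 2 * ((rhoCutRe t : ℂ) - Real.pi * Complex.I))) =
      ((-(1 / (t * (1 - t) ^ 2)) : ℝ) : ℂ) * ((rhoCutRe t : ℂ) - Real.pi * Complex.I)⁻¹ := by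
    push_cast
    rw [← sub_eq_add_neg, one_div, mul_inv, one_div, neg_mul, inv_neg]
  rw [e, Complex.im_ofReal_mul]
  rw [Complex.inv_im]
  have hn : Complex.normSq ((rhoCutRe t : ℂ) - Real.pi * Complex.I) =
      rhoCutRe t ^ 2 + Real.pi ^ 2 := by
    simp [Complex.normSq_apply]
    ring
  have hne : rhoCutRe t ^ 2 + Real.pi ^ 2 ≠ 0 := by positivity
  rw [hn, gDensity]
  simp
  field_simp

/-! ### The contour integral over the strip -/

theorem differentiable_dslope {f : ℂ → ℂ} (hf : Differentiable ℂ f) (c : ℂ) :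
    Differentiable ℂ (dslope f c) :=
  differentiableOn_univ.1 ((Complex.differentiableOn_dslope univ_mem).2 hf.differentiableOn)

theorem differentiable_rhoStrip : Differentiable ℂ rhoStrip := by
  unfold rhoStrip
  fun_prop

theorem rhoStrip_zero : rhoStrip 0 = 0 := by simp [rhoStrip]

theorem hasDerivAt_rhoStrip_zero : HasDerivAt rhoStrip 0 0 := by
  have h : HasDerivAt (fun w : ℂ => Complex.exp (-w)) (Complex.exp (-0) * -1) 0 :=
    ((hasDerivAt_id (0 : ℂ)).neg).cexp
  have := ((hasDerivAt_id (0 : ℂ)).sub_const 1).add h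
  convert! this using 1
  simp

/-- `rhoStrip w / w ^ 2`, extended to `w = 0`. -/
noncomputable def rhoStripQuot : ℂ → ℂ := dslope (dslope rhoStrip 0) 0

theorem rhoStripQuot_of_ne {w : ℂ} (hw : w ≠ 0) : rhoStripQuot w = rhoStrip w / w ^ 2 := by
  rw [rhoStripQuot, dslope_of_ne _ hw, slope_def_field, dslope_of_ne _ hw, slope_def_field,
    dslope_same, hasDerivAt_rhoStrip_zero.deriv, rhoStrip_zero]
  field_simp
  ring

theorem differentiable_rhoStripQuot : Differentiable ℂ rhoStripQuot :=
  differentiable_dslope (differentiable_dslope differentiable_rhoStrip 0) 0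

/-- The value is `1/2`. Only the lower bound for its real part is needed; along `w = -u` with `u >
0` it is the inequality `1 + u + u²/2 ≤ eᵘ`. -/
theorem rhoStripQuot_zero_ne_zero : rhoStripQuot 0 ≠ 0 := by
  have hc : Tendsto (fun u : ℝ => (rhoStripQuot (-u : ℂ)).re) (𝓝[>] 0) (𝓝 (rhoStripQuot 0).re) := by
    refine Tendsto.mono_left ?_ nhdsWithin_le_nhds
    have h := differentiable_rhoStripQuot.continuous
    have : Continuous (fun u : ℝ => (rhoStripQuot (-u : ℂ)).re) := by fun_prop
    simpa using this.tendsto 0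
  have hle : (1 / 2 : ℝ) ≤ (rhoStripQuot 0).re := by
    refine ge_of_tendsto hc ?_
    filter_upwards [self_mem_nhdsWithin] with u hu
    have hu : 0 < u := hu
    have hne : (-u : ℂ) ≠ 0 := by simpa using hu.ne'
    have e : rhoStripQuot (-u : ℂ) = (((-u - 1 + Real.exp u) / u ^ 2 : ℝ) : ℂ) := by
      rw [rhoStripQuot_of_ne hne, rhoStrip]
      push_cast
      simp
    rw [e, Complex.ofReal_re, le_div_iff₀ (by positivity)]
    have := Real.quadratic_le_exp_of_nonneg hu.le
    linarith
  intro h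
  rw [h, Complex.zero_re] at hle
  norm_num at hle

theorem rhoStripQuot_ne_zero {w : ℂ} (hw : |w.im| ≤ Real.pi) : rhoStripQuot w ≠ 0 := by
  rcases eq_or_ne w 0 with rfl | h0
  · exact rhoStripQuot_zero_ne_zero
  · rw [rhoStripQuot_of_ne h0]
    exact div_ne_zero (rhoStrip_ne_zero hw h0) (pow_ne_zero 2 h0)

/-- Equal exponentials differ by a multiple of `2πi`, whereas the distance of `Im w` from the real
axis is at most `π`. -/
theorem exp_sub_exp_ofReal_ne_zero {w : ℂ} {r : ℝ} (hw : |w.im| ≤ Real.pi) (h : w ≠ r) :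
    Complex.exp w - Complex.exp r ≠ 0 := by
  intro he
  obtain ⟨n, hn⟩ := Complex.exp_eq_exp_iff_exists_int.1 (sub_eq_zero.1 he)
  have him := congrArg Complex.im hn
  have hpi := Real.pi_pos
  simp at him
  have hn0 : n = 0 := by
    rw [him, abs_mul, abs_of_pos (by positivity : 0 < 2 * Real.pi)] at hw
    have h1 : |(n : ℝ)| < 1 := by
      by_contra! h1
      nlinarith
    rw [← Int.cast_abs] at h1
    exact Int.abs_lt_one_iff.1 (by exact_mod_cast h1)
  apply h
  rw [hn, hn0]
  simp

theorem dslope_exp_ne_zero {w : ℂ} {r : ℝ} (hw : |w.im| ≤ Real.pi) :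
    dslope Complex.exp r w ≠ 0 := by
  rcases eq_or_ne w r with rfl | h
  · rw [dslope_same, Complex.deriv_exp]
    exact Complex.exp_ne_zero _
  · rw [dslope_of_ne _ h, slope_def_field]
    exact div_ne_zero (exp_sub_exp_ofReal_ne_zero hw h) (sub_ne_zero.2 h)

/-- The point of the strip corresponding to `z = x`. -/
noncomputable def stripPoint (x : ℝ) : ℝ := Real.log (1 + 1 / x)

theorem exp_stripPoint {x : ℝ} (hx : 0 < x) : Real.exp (stripPoint x) = (x + 1) / x := by
  rw [stripPoint, Real.exp_log (by positivity)]
  field_simp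

theorem stripPoint_pos {x : ℝ} (hx : 0 < x) : 0 < stripPoint x :=
  Real.log_pos (by have : 0 < 1 / x := by positivity
                   linarith)

theorem cexp_stripPoint {x : ℝ} (hx : 0 < x) :
    Complex.exp (stripPoint x) = ((x : ℂ) + 1) / x := by
  rw [← Complex.ofReal_exp, exp_stripPoint hx]
  push_cast
  rfl

theorem rhoStrip_stripPoint {x : ℝ} (hx : 0 < x) : rhoStrip (stripPoint x) = (rho x : ℂ) := by
  have hxc : (x : ℂ) ≠ 0 := by exact_mod_cast hx.ne'
  have hx1 : (x : ℂ) + 1 ≠ 0 := by exact_mod_cast (by positivity : x + 1 ≠ 0)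
  have hx2 : 1 + (x : ℂ) ≠ 0 := by rwa [add_comm]
  rw [rhoStrip, Complex.exp_neg, cexp_stripPoint hx, rho, stripPoint]
  push_cast
  field_simp
  ring

/-- In the coordinate `w`, the form `G(z) dz / (z - x)` is `stripKernel x w dw`. -/
noncomputable def stripKernel (x : ℝ) (w : ℂ) : ℂ :=
  (1 - Complex.exp (-w)) * (Complex.exp w - 1) /
    (rhoStrip w * (x * (Complex.exp w - Complex.exp (stripPoint x))))

/-- `stripKernel x w * (w - stripPoint x)` with removable singularities removed. -/
noncomputable def stripNum (x : ℝ) (w : ℂ) : ℂ :=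
  Complex.exp (-w) * dslope Complex.exp 0 w ^ 2 /
    (rhoStripQuot w * (x * dslope Complex.exp (stripPoint x) w))

/-- The numerator of `stripKernel` is `e⁻ʷ (eʷ - 1)²`, whose double zero at `w = 0` cancels that of
`rhoStrip`; the point `z = ∞` is therefore harmless. The closed strip is included, so the boundary
values on the cut are ordinary values. -/
theorem differentiableAt_stripNum {x : ℝ} (hx : 0 < x) {w : ℂ} (hw : |w.im| ≤ Real.pi) :
    DifferentiableAt ℂ (stripNum x) w := by
  have hxc : (x : ℂ) ≠ 0 := by exact_mod_cast hx.ne'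
  have h1 := differentiable_dslope Complex.differentiable_exp 0 w
  have h2 := differentiable_dslope Complex.differentiable_exp (stripPoint x) w
  have h3 := differentiable_rhoStripQuot w
  have h4 : DifferentiableAt ℂ (fun w : ℂ => Complex.exp (-w)) w := by fun_prop
  exact (h4.mul (h1.pow 2)).div (h3.mul ((differentiableAt_const _).mul h2))
    (mul_ne_zero (rhoStripQuot_ne_zero hw) (mul_ne_zero hxc (dslope_exp_ne_zero hw)))

theorem stripNum_stripPoint {x : ℝ} (hx : 0 < x) : stripNum x (stripPoint x) = (gFun x : ℂ) := by
  have hxc : (x : ℂ) ≠ 0 := by exact_mod_cast hx.ne'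
  have hx1 : (x : ℂ) + 1 ≠ 0 := by exact_mod_cast (by positivity : x + 1 ≠ 0)
  have hx2 : 1 + (x : ℂ) ≠ 0 := by rwa [add_comm]
  have h0 : (stripPoint x : ℂ) ≠ 0 := by exact_mod_cast (stripPoint_pos hx).ne'
  have hr : (rho x : ℂ) ≠ 0 := by exact_mod_cast (rho_pos hx).ne'
  rw [stripNum, rhoStripQuot_of_ne h0, rhoStrip_stripPoint hx, dslope_same, Complex.deriv_exp,
    dslope_of_ne _ h0, slope_def_field, Complex.exp_neg, Complex.exp_zero, cexp_stripPoint hx,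
    gFun_eq hx]
  push_cast
  field_simp
  ring

theorem stripNum_div_eq_stripKernel {x : ℝ} (hx : 0 < x) {w : ℂ} (hw : |w.im| ≤ Real.pi)
    (h0 : w ≠ 0) (hwx : w ≠ stripPoint x) :
    stripNum x w / (w - stripPoint x) = stripKernel x w := by
  have hxc : (x : ℂ) ≠ 0 := by exact_mod_cast hx.ne'
  have h1 := exp_sub_exp_ofReal_ne_zero hw hwx
  have h2 := sub_ne_zero.2 hwx
  have h3 := rhoStrip_ne_zero hw h0
  have h4 := Complex.exp_ne_zero w
  rw [stripNum, stripKernel, rhoStripQuot_of_ne h0, dslope_of_ne _ h0, slope_def_field,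
    dslope_of_ne _ hwx, slope_def_field, Complex.exp_neg, Complex.exp_zero]
  field_simp
  ring

/-- `stripKernel x` with its pole subtracted. -/
noncomputable def stripRegular (x : ℝ) : ℂ → ℂ := dslope (stripNum x) (stripPoint x)

theorem stripRegular_eq {x : ℝ} (hx : 0 < x) {w : ℂ} (hw : |w.im| ≤ Real.pi)
    (h0 : w ≠ 0) (hwx : w ≠ stripPoint x) :
    stripRegular x w = stripKernel x w - gFun x / (w - stripPoint x) := by
  rw [stripRegular, dslope_of_ne _ hwx, slope_def_field, sub_div, stripNum_stripPoint hx,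
    stripNum_div_eq_stripKernel hx hw h0 hwx]

theorem continuousAt_stripRegular {x : ℝ} (hx : 0 < x) {w : ℂ} (hw : |w.im| ≤ Real.pi) :
    ContinuousAt (stripRegular x) w := by
  rcases eq_or_ne w (stripPoint x) with rfl | h
  · exact continuousAt_dslope_same.2 (differentiableAt_stripNum hx hw)
  · exact (continuousAt_dslope_of_ne h).2 (differentiableAt_stripNum hx hw).continuousAt

/-- Cauchy's theorem tolerates a countable exceptional set where only continuity is known, so
differentiability of `stripRegular x` at `stripPoint x` need not be proved. -/
theorem integral_boundary_stripRegular {x : ℝ} (hx : 0 < x) (R : ℝ) :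
    (∫ u : ℝ in -R..R, stripRegular x (u + (-Real.pi : ℝ) * Complex.I)) -
      (∫ u : ℝ in -R..R, stripRegular x (u + (Real.pi : ℝ) * Complex.I)) +
      Complex.I • (∫ y : ℝ in -Real.pi..Real.pi, stripRegular x ((R : ℝ) + y * Complex.I)) -
      Complex.I • (∫ y : ℝ in -Real.pi..Real.pi, stripRegular x ((-R : ℝ) + y * Complex.I)) = 0 := by
  have hpi := Real.pi_pos
  have hsub : ∀ w : ℂ, w.im ∈ Icc (-Real.pi) Real.pi → |w.im| ≤ Real.pi := fun w h => abs_le.2 h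
  refine Complex.integral_boundary_rect_eq_zero_of_differentiable_on_off_countable
    (stripRegular x) ⟨-R, -Real.pi⟩ ⟨R, Real.pi⟩ {(stripPoint x : ℂ)} (countable_singleton _) ?_ ?_
  · intro w hw
    have h := hw.2
    simp only [mem_preimage, uIcc_of_le (by linarith : -Real.pi ≤ Real.pi)] at h
    exact (continuousAt_stripRegular hx (hsub w h)).continuousWithinAt
  · intro w hw
    have h := hw.1.2
    simp only [mem_preimage, min_eq_left (by linarith : -Real.pi ≤ Real.pi),
      max_eq_right (by linarith : -Real.pi ≤ Real.pi)] at h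
    exact (differentiableAt_dslope_of_ne hw.2).2
      (differentiableAt_stripNum hx (hsub w (Ioo_subset_Icc_self h)))

/-! ### Limits of the sides of the rectangle -/

/-- The filter of points of the closed strip `|Im w| ≤ π` whose real part tends along `l`. -/
def stripFilter (l : Filter ℝ) : Filter ℂ :=
  comap Complex.re l ⊓ 𝓟 {w | |w.im| ≤ Real.pi}

theorem tendsto_re_stripFilter (l : Filter ℝ) : Tendsto Complex.re (stripFilter l) l :=
  tendsto_comap.mono_left inf_le_left

theorem eventually_stripFilter (l : Filter ℝ) : ∀ᶠ w in stripFilter l, |w.im| ≤ Real.pi :=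
  mem_inf_of_right (mem_principal_self _)

theorem tendsto_vertical_integral {F : ℂ → ℂ} {ℓ : ℂ} {l : Filter ℝ} {r : ℝ → ℝ}
    (hF : ∀ w : ℂ, |w.im| ≤ Real.pi → ContinuousAt F w) (hr : Tendsto r atTop l)
    (h : Tendsto F (stripFilter l) (𝓝 ℓ)) :
    Tendsto (fun R : ℝ => ∫ y : ℝ in -Real.pi..Real.pi, F ((r R : ℝ) + y * Complex.I)) atTop
      (𝓝 (2 * Real.pi * ℓ)) := by
  have hpi := Real.pi_pos
  have hab : -Real.pi ≤ Real.pi := by linarith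
  have hlim : 2 * Real.pi * ℓ = ∫ y : ℝ in -Real.pi..Real.pi, ℓ := by
    rw [intervalIntegral.integral_const, Complex.real_smul]
    push_cast
    ring
  rw [hlim]
  have hpath : ∀ y : ℝ, |y| ≤ Real.pi →
      Tendsto (fun R : ℝ => ((r R : ℝ) + y * Complex.I : ℂ)) atTop (stripFilter l) := by
    intro y hy
    refine tendsto_inf.2 ⟨tendsto_comap_iff.2 ?_, tendsto_principal.2 ?_⟩
    · refine hr.congr fun R => ?_
      simp
    · refine Eventually.of_forall fun R => ?_
      simpa using hy
  refine intervalIntegral.tendsto_integral_filter_of_dominated_convergence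
    (fun _ => ‖ℓ‖ + 1) ?_ ?_ intervalIntegrable_const ?_
  · refine Eventually.of_forall fun R => ?_
    refine ContinuousOn.aestronglyMeasurable ?_ measurableSet_uIoc
    intro y hy
    rw [uIoc_of_le hab] at hy
    have hc : ContinuousAt F ((r R : ℝ) + y * Complex.I) :=
      hF _ (by simpa using abs_le.2 ⟨hy.1.le, hy.2⟩)
    exact (ContinuousAt.comp (f := fun y : ℝ => ((r R : ℝ) + y * Complex.I : ℂ)) hc
      (by fun_prop)).continuousWithinAt
  -- Convergence along `stripFilter l` is uniform in the height `y`, so one constant dominates the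
  -- whole side.
  · have hb : ∀ᶠ w in stripFilter l, ‖F w‖ ≤ ‖ℓ‖ + 1 :=
      (h.norm.eventually (gt_mem_nhds (lt_add_one ‖ℓ‖))).mono fun w hw => le_of_lt hw
    obtain ⟨s, hs, t, ht, hst⟩ := mem_inf_iff_superset.1 hb
    obtain ⟨v, hv, hvs⟩ := mem_comap.1 hs
    filter_upwards [hr hv] with R hR
    refine Eventually.of_forall fun y hy => ?_
    rw [uIoc_of_le hab] at hy
    refine hst ⟨hvs (by simpa using hR), ht ?_⟩
    simpa using abs_le.2 ⟨hy.1.le, hy.2⟩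
  · refine Eventually.of_forall fun y hy => ?_
    rw [uIoc_of_le hab] at hy
    exact h.comp (hpath y (abs_le.2 ⟨hy.1.le, hy.2⟩))

theorem tendsto_inv_zero_of_re_atTop {l : Filter ℂ} {F : ℂ → ℂ}
    (h : Tendsto (fun w => |(F w).re|) l atTop) : Tendsto (fun w => (F w)⁻¹) l (𝓝 0) := by
  refine Filter.tendsto_inv₀_cobounded.comp ?_
  rw [← tendsto_norm_atTop_iff_cobounded]
  exact tendsto_atTop_mono (fun w => Complex.abs_re_le_norm _) h

theorem tendsto_inv_sub_stripFilter {l : Filter ℝ} (hl : Tendsto (fun u => |u|) l atTop) (r : ℝ) :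
    Tendsto (fun w : ℂ => (w - r)⁻¹) (stripFilter l) (𝓝 0) := by
  refine tendsto_inv_zero_of_re_atTop ?_
  have h := tendsto_atTop_add_const_right _ (-|r|) (hl.comp (tendsto_re_stripFilter l))
  refine tendsto_atTop_mono (fun w => ?_) h
  have := abs_sub_abs_le_abs_sub w.re r
  simpa [sub_eq_add_neg] using this

theorem eventually_ne_ofReal_stripFilter {l : Filter ℝ} (hl : Tendsto (fun u => |u|) l atTop)
    (r : ℝ) : ∀ᶠ w : ℂ in stripFilter l, w ≠ r := by
  filter_upwards [(hl.comp (tendsto_re_stripFilter l)).eventually_gt_atTop |r|] with w hw h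
  simp [h] at hw

theorem stripRegular_eventuallyEq {x : ℝ} (hx : 0 < x) {l : Filter ℝ}
    (hl : Tendsto (fun u => |u|) l atTop) :
    (fun w => stripKernel x w - gFun x * (w - stripPoint x)⁻¹) =ᶠ[stripFilter l]
      stripRegular x := by
  filter_upwards [eventually_stripFilter l, eventually_ne_ofReal_stripFilter hl (stripPoint x),
    eventually_ne_ofReal_stripFilter hl 0] with w h1 h2 h3
  rw [stripRegular_eq hx h1 (by simpa using h3) h2, div_eq_mul_inv]

theorem tendsto_stripRegular {x : ℝ} (hx : 0 < x) {l : Filter ℝ} {ℓ : ℂ}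
    (hl : Tendsto (fun u => |u|) l atTop) (h : Tendsto (stripKernel x) (stripFilter l) (𝓝 ℓ)) :
    Tendsto (stripRegular x) (stripFilter l) (𝓝 ℓ) := by
  refine Tendsto.congr' (stripRegular_eventuallyEq hx hl) ?_
  simpa using h.sub ((tendsto_inv_sub_stripFilter hl (stripPoint x)).const_mul (gFun x : ℂ))

theorem tendsto_exp_neg_stripFilter_atTop :
    Tendsto (fun w : ℂ => Complex.exp (-w)) (stripFilter atTop) (𝓝 0) := by
  refine Complex.tendsto_exp_comap_re_atBot.comp ?_
  refine tendsto_comap_iff.2 ?_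
  exact (tendsto_neg_atTop_atBot.comp (tendsto_re_stripFilter atTop)).congr fun w => by simp

/-- After division by `eʷ` every factor stays bounded except `1 / rhoStrip w`, which tends to `0`
because `Re (rhoStrip w) ≥ Re w - 2`. -/
theorem tendsto_stripKernel_atTop {x : ℝ} (hx : 0 < x) :
    Tendsto (stripKernel x) (stripFilter atTop) (𝓝 0) := by
  have hxc : (x : ℂ) ≠ 0 := by exact_mod_cast hx.ne'
  have he := tendsto_exp_neg_stripFilter_atTop
  have hP : Tendsto (fun w => (rhoStrip w)⁻¹) (stripFilter atTop) (𝓝 0) := by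
    refine tendsto_inv_zero_of_re_atTop ?_
    have hre := tendsto_re_stripFilter atTop
    refine tendsto_atTop_mono' _ ?_ (tendsto_atTop_add_const_right _ (-2) hre)
    filter_upwards [hre.eventually_ge_atTop 0] with w hw
    refine le_trans ?_ (le_abs_self _)
    rw [rhoStrip_re]
    have h1 : Real.exp (-w.re) ≤ 1 := Real.exp_le_one_iff.2 (by linarith)
    have h2 := Real.neg_one_le_cos w.im
    have h3 := Real.exp_pos (-w.re)
    nlinarith
  have hmain : Tendsto (fun w : ℂ => (1 - Complex.exp (-w)) ^ 2 /
      (x * (1 - Complex.exp (stripPoint x) * Complex.exp (-w))) * (rhoStrip w)⁻¹)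
      (stripFilter atTop) (𝓝 ((1 - 0) ^ 2 / (x * (1 - Complex.exp (stripPoint x) * 0)) * 0)) := by
    refine Tendsto.mul (((he.const_sub 1).pow 2).div
      (((he.const_mul _).const_sub 1).const_mul _) ?_) hP
    simpa using hxc
  rw [mul_zero] at hmain
  refine hmain.congr fun w => ?_
  have h4 := Complex.exp_ne_zero w
  have e1 : 1 - Complex.exp (-w) = (Complex.exp w - 1) * Complex.exp (-w) := by
    rw [Complex.exp_neg]; field_simp
  have e2 : 1 - Complex.exp (stripPoint x) * Complex.exp (-w) =
      (Complex.exp w - Complex.exp (stripPoint x)) * Complex.exp (-w) := by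
    rw [Complex.exp_neg]; field_simp
  have h5 := Complex.exp_ne_zero (-w)
  rw [stripKernel, e2, pow_two]
  nth_rewrite 2 [e1]
  rw [← mul_assoc (x : ℂ), ← mul_assoc, mul_div_mul_right _ _ h5, ← div_eq_mul_inv, div_div]
  congr 1
  ring

theorem tendsto_exp_stripFilter_atBot :
    Tendsto Complex.exp (stripFilter atBot) (𝓝 0) :=
  Complex.tendsto_exp_comap_re_atBot.mono_left inf_le_left

theorem tendsto_mul_exp_stripFilter_atBot :
    Tendsto (fun w : ℂ => w * Complex.exp w) (stripFilter atBot) (𝓝 0) := by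
  have h1 : Tendsto (fun u : ℝ => |u| * Real.exp u) atBot (𝓝 0) := by
    have h := (Real.tendsto_pow_mul_exp_neg_atTop_nhds_zero 1).comp tendsto_neg_atBot_atTop
    refine h.congr' ?_
    filter_upwards [eventually_le_atBot 0] with u hu
    simp [abs_of_nonpos hu]
  have h2 : Tendsto (fun u : ℝ => (|u| + Real.pi) * Real.exp u) atBot (𝓝 0) := by
    have := h1.add (Real.tendsto_exp_atBot.const_mul Real.pi)
    simpa [add_mul] using this
  refine squeeze_zero_norm' ?_ (h2.comp (tendsto_re_stripFilter atBot))
  filter_upwards [eventually_stripFilter atBot] with w hw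
  rw [norm_mul, Complex.norm_exp]
  have := Complex.norm_le_abs_re_add_abs_im w
  exact mul_le_mul_of_nonneg_right (by linarith) (Real.exp_pos _).le

/-- Numerator and denominator are multiplied by `eʷ`, so that `eʷ rhoStrip w = w eʷ - eʷ + 1` tends
to `1`. This limit is the source of the term `1/(1 + x)`. -/
theorem tendsto_stripKernel_atBot {x : ℝ} (hx : 0 < x) :
    Tendsto (stripKernel x) (stripFilter atBot) (𝓝 (-(1 / (1 + x)))) := by
  have hxc : (x : ℂ) ≠ 0 := by exact_mod_cast hx.ne'
  have hx1 : (x : ℂ) + 1 ≠ 0 := by exact_mod_cast (by positivity : x + 1 ≠ 0)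
  have he := tendsto_exp_stripFilter_atBot
  have hm := tendsto_mul_exp_stripFilter_atBot
  have hmain : Tendsto (fun w : ℂ => (Complex.exp w - 1) ^ 2 /
      ((w * Complex.exp w - Complex.exp w + 1) *
        (x * (Complex.exp w - Complex.exp (stripPoint x)))))
      (stripFilter atBot) (𝓝 ((0 - 1) ^ 2 / ((0 - 0 + 1) *
        (x * (0 - Complex.exp (stripPoint x)))))) := by
    refine ((he.sub_const 1).pow 2).div (((hm.sub he).add_const 1).mul
      ((he.sub_const _).const_mul _)) ?_
    simpa using hxc
  have hl : ((0 - 1) ^ 2 / ((0 - 0 + 1) * (x * (0 - Complex.exp (stripPoint x)))) : ℂ) =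
      -(1 / (1 + x)) := by
    have hx2 : 1 + (x : ℂ) ≠ 0 := by rwa [add_comm]
    rw [cexp_stripPoint hx]
    have : (x : ℂ) * (0 - (x + 1) / x) = -(1 + x) := by field_simp; ring
    rw [this]
    field_simp
    ring
  rw [hl] at hmain
  refine hmain.congr fun w => ?_
  have h4 := Complex.exp_ne_zero w
  have e1 : (1 - Complex.exp (-w)) * Complex.exp w = Complex.exp w - 1 := by
    rw [Complex.exp_neg]; field_simp
  have e2 : rhoStrip w * Complex.exp w = w * Complex.exp w - Complex.exp w + 1 := by
    rw [rhoStrip, Complex.exp_neg]; field_simp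
  rw [stripKernel, ← e2, pow_two]
  nth_rewrite 1 [← e1]
  rw [mul_right_comm, mul_right_comm (rhoStrip w), mul_div_mul_right _ _ h4]

/-! ### The horizontal sides -/

theorem stripKernel_horizontal {x : ℝ} (u : ℝ) {σ : ℝ} (hσ : σ = Real.pi ∨ σ = -Real.pi) :
    stripKernel x (u + σ * Complex.I) =
      ((1 + Real.exp (-u)) * (Real.exp u + 1) / (x * (Real.exp u + Real.exp (stripPoint x))) : ℝ) /
        ((u - 1 - Real.exp (-u) : ℝ) + σ * Complex.I) := by
  have hI : Complex.exp (σ * Complex.I) = -1 ∧ Complex.exp (-(σ * Complex.I)) = -1 := by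
    rcases hσ with rfl | rfl <;> simp [Complex.exp_neg, Complex.exp_pi_mul_I]
  have h1 : Complex.exp (u + σ * Complex.I) = -Complex.exp u := by
    rw [Complex.exp_add, hI.1]; ring
  have h2 : Complex.exp (-(u + σ * Complex.I)) = -Complex.exp (-u) := by
    rw [neg_add, Complex.exp_add, hI.2]; ring
  have h3 : rhoStrip (u + σ * Complex.I) = (u - 1 - Real.exp (-u) : ℝ) + σ * Complex.I := by
    rw [rhoStrip, h2]
    push_cast
    ring
  rw [stripKernel, h3, h1, h2]
  push_cast
  rw [div_div, mul_comm (_ + _ : ℂ) ((x : ℂ) * _), ← neg_div_neg_eq]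
  congr 1 <;> ring

theorem inv_sub_pi_mul_I_sub_inv_add (v : ℝ) :
    1 / ((v : ℂ) + (-Real.pi : ℝ) * Complex.I) - 1 / ((v : ℂ) + (Real.pi : ℝ) * Complex.I) =
      2 * Real.pi * Complex.I * ((1 / (v ^ 2 + Real.pi ^ 2) : ℝ) : ℂ) := by
  have hpi := Real.pi_pos.ne'
  have key : ((v : ℂ) + (-Real.pi : ℝ) * Complex.I) * ((v : ℂ) + (Real.pi : ℝ) * Complex.I) =
      ((v ^ 2 + Real.pi ^ 2 : ℝ) : ℂ) := by
    push_cast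
    linear_combination -(Real.pi : ℂ) ^ 2 * Complex.I_sq
  have hne : ((v ^ 2 + Real.pi ^ 2 : ℝ) : ℂ) ≠ 0 := by
    exact_mod_cast (by positivity : v ^ 2 + Real.pi ^ 2 ≠ 0)
  have h1 := left_ne_zero_of_mul (key ▸ hne)
  have h2 := right_ne_zero_of_mul (key ▸ hne)
  rw [div_sub_div _ _ h1 h2, key, Complex.ofReal_div, mul_div_assoc']
  congr 1
  push_cast
  ring

/-- The pullback of the density `gDensity t / (x + t) dt` under `t = 1 / (1 + exp u)`. -/
noncomputable def lineDensity (x u : ℝ) : ℝ :=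
  (1 + Real.exp (-u)) * (Real.exp u + 1) / (x * (Real.exp u + Real.exp (stripPoint x))) *
    (1 / ((u - 1 - Real.exp (-u)) ^ 2 + Real.pi ^ 2))

/-- Since `e^{±πi} = -1`, the two lines differ only through the sign in `v ± πi`, and the difference
of reciprocals is `2πi / (v² + π²)`. The same identity handles the subtracted pole. -/
theorem stripRegular_horizontal_sub {x : ℝ} (hx : 0 < x) (u : ℝ) :
    stripRegular x (u + (-Real.pi : ℝ) * Complex.I) - stripRegular x (u + (Real.pi : ℝ) * Complex.I) =
      2 * Real.pi * Complex.I *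
        ((lineDensity x u - gFun x * (1 / ((u - stripPoint x) ^ 2 + Real.pi ^ 2)) : ℝ) : ℂ) := by
  have hpi := Real.pi_pos
  have hne : ∀ (r σ : ℝ), σ ≠ 0 → (u + σ * Complex.I : ℂ) ≠ r := by
    intro r σ hσ h
    have := congrArg Complex.im h
    simp at this
    exact hσ this
  have h1 := hne 0 _ hpi.ne'
  have h2 := hne 0 _ (neg_ne_zero.2 hpi.ne')
  rw [Complex.ofReal_zero] at h1 h2
  rw [stripRegular_eq hx (by simp [abs_of_pos hpi]) h2 (hne _ _ (neg_ne_zero.2 hpi.ne')),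
    stripRegular_eq hx (by simp [abs_of_pos hpi]) h1 (hne _ _ hpi.ne'),
    stripKernel_horizontal u (Or.inr rfl), stripKernel_horizontal u (Or.inl rfl)]
  have e1 := inv_sub_pi_mul_I_sub_inv_add (u - 1 - Real.exp (-u))
  have e2 := inv_sub_pi_mul_I_sub_inv_add (u - stripPoint x)
  have e3 : ∀ σ : ℝ, (u + σ * Complex.I - stripPoint x : ℂ) =
      ((u - stripPoint x : ℝ) : ℂ) + σ * Complex.I := by
    intro σ
    push_cast
    ring
  rw [e3, e3, lineDensity, Complex.ofReal_sub (_ * _) (_ * _), Complex.ofReal_mul,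
    Complex.ofReal_mul (gFun x)]
  linear_combination (((1 + Real.exp (-u)) * (Real.exp u + 1) /
    (x * (Real.exp u + Real.exp (stripPoint x))) : ℝ) : ℂ) * e1 - (gFun x : ℂ) * e2

/-! ### The integral representation of `gFun` -/

theorem continuousOn_gDensity : ContinuousOn gDensity (Ioo 0 1) := by
  intro t ht
  have h := (hasDerivAt_rhoCutRe ht).continuousAt
  have h0 := ht.1
  have h1 : 0 < 1 - t := by linarith [ht.2]
  have hpi := Real.pi_pos
  refine ContinuousAt.continuousWithinAt ?_
  unfold gDensity
  have h2 : ContinuousAt (fun t : ℝ => t * (1 - t) ^ 2) t := by fun_prop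
  exact continuousAt_const.div (h2.mul ((h.pow 2).add continuousAt_const)) (by positivity)

theorem one_div_one_add_exp_mem (u : ℝ) : 1 / (1 + Real.exp u) ∈ Ioo (0 : ℝ) 1 := by
  have := Real.exp_pos u
  refine ⟨by positivity, ?_⟩
  rw [div_lt_one (by positivity)]
  linarith

/-- With `z = -t` and `t = 1/(1 + eᵘ)` one has `1 + 1/z = -eᵘ`. The substitution is decreasing,
hence the minus sign. -/
theorem lineDensity_eq {x : ℝ} (hx : 0 < x) (u : ℝ) :
    lineDensity x u = -(gDensity (1 / (1 + Real.exp u)) / (x + 1 / (1 + Real.exp u)) *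
      (-Real.exp u / (1 + Real.exp u) ^ 2)) := by
  have he := Real.exp_pos u
  have h1 : 1 - 1 / (1 + Real.exp u) = Real.exp u / (1 + Real.exp u) := by field_simp; ring
  have hA : rhoCutRe (1 / (1 + Real.exp u)) = u - 1 - Real.exp (-u) := by
    rw [rhoCutRe, h1, Real.log_div he.ne' (by positivity), one_div, Real.log_inv, Real.log_exp,
      Real.exp_neg]
    field_simp
    ring
  have hD : (u - 1 - Real.exp (-u)) ^ 2 + Real.pi ^ 2 ≠ 0 := by
    have := Real.pi_pos
    positivity
  rw [lineDensity, gDensity, hA, h1, exp_stripPoint hx]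
  generalize (u - 1 - Real.exp (-u)) ^ 2 + Real.pi ^ 2 = D at hD
  rw [Real.exp_neg]
  generalize Real.exp u = E at *
  have h2 : x * (1 + E) + 1 ≠ 0 := by positivity
  have h3 : x * E + (x + 1) ≠ 0 := by positivity
  field_simp
  ring

theorem integral_lineDensity {x : ℝ} (hx : 0 < x) (R : ℝ) :
    (∫ u in -R..R, lineDensity x u) =
      ∫ t in (1 / (1 + Real.exp R))..(1 / (1 + Real.exp (-R))), gDensity t / (x + t) := by
  have hd : ∀ u ∈ uIcc (-R) R, HasDerivAt (fun u : ℝ => 1 / (1 + Real.exp u))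
      (-Real.exp u / (1 + Real.exp u) ^ 2) u := by
    intro u _
    have he := Real.exp_pos u
    have := (hasDerivAt_const u (1 : ℝ)).div ((Real.hasDerivAt_exp u).const_add 1)
      (by positivity : 1 + Real.exp u ≠ 0)
    convert! this using 1
    ring
  have hc : ContinuousOn (fun u : ℝ => -Real.exp u / (1 + Real.exp u) ^ 2) (uIcc (-R) R) := by
    refine Continuous.continuousOn ?_
    have : ∀ u : ℝ, (1 + Real.exp u) ^ 2 ≠ 0 := fun u => by positivity
    fun_prop (disch := assumption)
  have h := intervalIntegral.integral_comp_mul_deriv' (g := fun t => gDensity t / (x + t)) hd hc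
    (by
      have hsub : (fun u : ℝ => 1 / (1 + Real.exp u)) '' uIcc (-R) R ⊆ Ioo 0 1 := by
        rintro _ ⟨u, _, rfl⟩
        exact one_div_one_add_exp_mem u
      refine (continuousOn_gDensity.mono hsub).div (by fun_prop) fun t ht => ?_
      have := (hsub ht).1
      positivity)
  rw [intervalIntegral.integral_symm (1 / (1 + Real.exp (-R))), ← h, ← intervalIntegral.integral_neg]
  exact intervalIntegral.integral_congr fun u _ => lineDensity_eq hx u

theorem intervalIntegrable_gDensity_div {x : ℝ} (hx : 0 < x) :
    IntervalIntegrable (fun t => gDensity t / (x + t)) volume 0 1 := by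
  simp_rw [div_eq_mul_inv]
  refine intervalIntegrable_gDensity.mul_continuousOn ?_
  rw [uIcc_of_le zero_le_one]
  refine ContinuousOn.inv₀ (by fun_prop) fun t ht => ?_
  have := ht.1
  positivity

theorem tendsto_integral_lineDensity {x : ℝ} (hx : 0 < x) :
    Tendsto (fun R : ℝ => ∫ u in -R..R, lineDensity x u) atTop
      (𝓝 (∫ t in (0 : ℝ)..1, gDensity t / (x + t))) := by
  have hint := intervalIntegrable_gDensity_div hx
  have hcont := intervalIntegral.continuousOn_primitive_interval
    ((intervalIntegrable_iff' (by finiteness)).1 hint)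
  rw [uIcc_of_le zero_le_one] at hcont
  have ha : Tendsto (fun R : ℝ => 1 / (1 + Real.exp R)) atTop (𝓝[Icc 0 1] 0) := by
    refine tendsto_nhdsWithin_iff.2 ⟨?_, Eventually.of_forall fun R =>
      Ioo_subset_Icc_self (one_div_one_add_exp_mem R)⟩
    exact tendsto_const_nhds.div_atTop (tendsto_atTop_add_const_left _ _ Real.tendsto_exp_atTop)
  have hb : Tendsto (fun R : ℝ => 1 / (1 + Real.exp (-R))) atTop (𝓝[Icc 0 1] 1) := by
    refine tendsto_nhdsWithin_iff.2 ⟨?_, Eventually.of_forall fun R =>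
      Ioo_subset_Icc_self (one_div_one_add_exp_mem (-R))⟩
    have h := (Real.tendsto_exp_neg_atTop_nhds_zero.const_add 1)
    simpa using h.inv₀ (by norm_num)
  have h0 := (hcont 0 (left_mem_Icc.2 zero_le_one)).tendsto.comp ha
  have h1 := (hcont 1 (right_mem_Icc.2 zero_le_one)).tendsto.comp hb
  have hsub := h1.sub h0
  rw [intervalIntegral.integral_same, sub_zero] at hsub
  refine hsub.congr fun R => ?_
  rw [integral_lineDensity hx]
  have hii : ∀ u : ℝ, IntervalIntegrable (fun t => gDensity t / (x + t)) volume 0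
      (1 / (1 + Real.exp u)) := by
    intro u
    have hm := Ioo_subset_Icc_self (one_div_one_add_exp_mem u)
    refine hint.mono_set ?_
    rw [uIcc_of_le hm.1, uIcc_of_le zero_le_one]
    exact Icc_subset_Icc_right hm.2
  exact intervalIntegral.integral_interval_sub_left (hii _) (hii _)

theorem hasDerivAt_arctan_shift (r u : ℝ) :
    HasDerivAt (fun u : ℝ => 1 / Real.pi * Real.arctan ((u - r) / Real.pi))
      (1 / ((u - r) ^ 2 + Real.pi ^ 2)) u := by
  have hpi := Real.pi_pos.ne'
  have h := ((((hasDerivAt_id u).sub_const r).div_const Real.pi).arctan).const_mul (1 / Real.pi)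
  convert! h using 1
  simp only [id]
  have : (u - r) ^ 2 + Real.pi ^ 2 ≠ 0 := by positivity
  have h' : 1 + ((u - r) / Real.pi) ^ 2 ≠ 0 := by positivity
  field_simp
  ring

theorem continuous_cauchyKernel (r : ℝ) :
    Continuous (fun u : ℝ => 1 / ((u - r) ^ 2 + Real.pi ^ 2)) := by
  have : ∀ u : ℝ, (u - r) ^ 2 + Real.pi ^ 2 ≠ 0 := fun u => by
    have := Real.pi_pos
    positivity
  fun_prop (disch := assumption)

theorem tendsto_integral_cauchyKernel (r : ℝ) :
    Tendsto (fun R : ℝ => ∫ u in -R..R, 1 / ((u - r) ^ 2 + Real.pi ^ 2)) atTop (𝓝 1) := by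
  have hpi := Real.pi_pos
  have h1 : Tendsto (fun R : ℝ => (R - r) / Real.pi) atTop atTop :=
    (tendsto_atTop_add_const_right _ (-r) tendsto_id).atTop_div_const hpi
  have h2 : Tendsto (fun R : ℝ => (-R - r) / Real.pi) atTop atBot :=
    (tendsto_atBot_add_const_right _ (-r) tendsto_neg_atTop_atBot).atBot_div_const hpi
  have h3 := ((tendsto_nhds_of_tendsto_nhdsWithin Real.tendsto_arctan_atTop).comp h1).const_mul
    (1 / Real.pi)
  have h4 := ((tendsto_nhds_of_tendsto_nhdsWithin Real.tendsto_arctan_atBot).comp h2).const_mul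
    (1 / Real.pi)
  have h5 := h3.sub h4
  have e : 1 / Real.pi * (Real.pi / 2) - 1 / Real.pi * (-(Real.pi / 2)) = 1 := by
    field_simp; norm_num
  rw [e] at h5
  refine h5.congr fun R => ?_
  rw [intervalIntegral.integral_eq_sub_of_hasDerivAt (fun u _ => hasDerivAt_arctan_shift r u)
    ((continuous_cauchyKernel r).intervalIntegrable _ _)]
  rfl

theorem continuous_lineDensity {x : ℝ} (hx : 0 < x) : Continuous (lineDensity x) := by
  have h1 : ∀ u : ℝ, (u - 1 - Real.exp (-u)) ^ 2 + Real.pi ^ 2 ≠ 0 := fun u => by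
    have := Real.pi_pos
    positivity
  have h2 : ∀ u : ℝ, x * (Real.exp u + Real.exp (stripPoint x)) ≠ 0 := fun u => by positivity
  unfold lineDensity
  fun_prop (disch := assumption)

/-- In the limit the four sides contribute `2πi (T - g(x))`, `0` and `2πi/(1 + x)`, and their sum is
zero. The residue `g(x)` enters through the subtracted pole, because `1/((u - r)² + π²)` has
integral `1` over the line. -/
theorem gFun_eq_integral {x : ℝ} (hx : 0 < x) :
    gFun x = 1 / (1 + x) + ∫ t in (0 : ℝ)..1, gDensity t / (x + t) := by
  have hpi := Real.pi_pos
  set T := ∫ t in (0 : ℝ)..1, gDensity t / (x + t) with hT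
  have hR := tendsto_vertical_integral (fun w hw => continuousAt_stripRegular hx hw) tendsto_id
    (tendsto_stripRegular hx tendsto_abs_atTop_atTop (tendsto_stripKernel_atTop hx))
  have hL := tendsto_vertical_integral (fun w hw => continuousAt_stripRegular hx hw)
    tendsto_neg_atTop_atBot
    (tendsto_stripRegular hx tendsto_abs_atBot_atTop (tendsto_stripKernel_atBot hx))
  have hH := (tendsto_integral_lineDensity hx).sub
    ((tendsto_integral_cauchyKernel (stripPoint x)).const_mul (gFun x))
  have hHC := ((Complex.continuous_ofReal.tendsto _).comp hH).const_mul
    (2 * Real.pi * Complex.I : ℂ)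
  have hsum := (hHC.add (hR.const_mul Complex.I)).sub (hL.const_mul Complex.I)
  have hzero : ∀ R : ℝ, (2 * Real.pi * Complex.I : ℂ) *
      (((∫ u in -R..R, lineDensity x u) -
        gFun x * ∫ u in -R..R, 1 / ((u - stripPoint x) ^ 2 + Real.pi ^ 2) : ℝ) : ℂ) +
      Complex.I * (∫ y : ℝ in -Real.pi..Real.pi, stripRegular x ((R : ℝ) + y * Complex.I)) -
      Complex.I * (∫ y : ℝ in -Real.pi..Real.pi, stripRegular x ((-R : ℝ) + y * Complex.I))
        = 0 := by
    intro R
    have h := integral_boundary_stripRegular hx R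
    have hint : ∀ σ : ℝ, |σ| ≤ Real.pi → IntervalIntegrable
        (fun u : ℝ => stripRegular x (u + σ * Complex.I)) volume (-R) R := by
      intro σ hσ
      refine Continuous.intervalIntegrable (continuous_iff_continuousAt.2 fun u => ?_) _ _
      exact ContinuousAt.comp (f := fun u : ℝ => (u + σ * Complex.I : ℂ))
        (continuousAt_stripRegular hx (by simpa using hσ)) (by fun_prop)
    rw [← intervalIntegral.integral_sub (hint _ (by simp [abs_of_pos hpi]))
      (hint _ (by simp [abs_of_pos hpi]))] at h
    simp_rw [stripRegular_horizontal_sub hx] at h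
    rw [intervalIntegral.integral_const_mul, intervalIntegral.integral_ofReal,
      intervalIntegral.integral_sub ((continuous_lineDensity hx).intervalIntegrable _ _)
        (((continuous_cauchyKernel _).const_mul _).intervalIntegrable _ _),
      intervalIntegral.integral_const_mul] at h
    simpa only [smul_eq_mul] using h
  have hlim := tendsto_nhds_unique (hsum.congr hzero) tendsto_const_nhds
  have hI : (2 * Real.pi * Complex.I : ℂ) ≠ 0 := by simp [hpi.ne']
  have hx1 : 1 + (x : ℂ) ≠ 0 := by exact_mod_cast (by positivity : 1 + x ≠ 0)
  have hC : (gFun x : ℂ) = ((1 / (1 + x) + T : ℝ) : ℂ) := by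
    refine mul_left_cancel₀ hI ?_
    push_cast at hlim ⊢
    linear_combination -hlim
  exact_mod_cast hC

/-! ### Laplace transforms and complete monotonicity -/

theorem integrableOn_pow_mul_exp_neg_mul (n : ℕ) {x : ℝ} (hx : 0 < x) :
    IntegrableOn (fun s : ℝ => s ^ n * Real.exp (-(x * s))) (Ioi 0) := by
  have h := integrableOn_rpow_mul_exp_neg_mul_rpow (p := 1) (s := n)
    (by have : (0 : ℝ) ≤ n := n.cast_nonneg
        linarith) one_pos hx
  refine h.congr_fun (fun s _ => ?_) measurableSet_Ioi
  simp

theorem integral_pow_mul_exp_neg_mul (n : ℕ) {x : ℝ} (hx : 0 < x) :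
    (∫ s in Ioi (0 : ℝ), s ^ n * Real.exp (-(x * s))) = (n ! : ℝ) / x ^ (n + 1) := by
  have h := Real.integral_rpow_mul_exp_neg_mul_Ioi (a := (n : ℝ) + 1) (r := x) (by positivity) hx
  rw [Real.Gamma_nat_eq_factorial, add_sub_cancel_right] at h
  simp_rw [Real.rpow_natCast] at h
  rw [h, ← Nat.cast_succ, Real.rpow_natCast, one_div, inv_pow]
  field_simp

theorem isCM_of_hasDerivAt {f : ℝ → ℝ} {F : ℕ → ℝ → ℝ}
    (hF : ∀ n x, 0 < x → HasDerivAt (F n) (F (n + 1) x) x) (hf : ∀ x, 0 < x → f x = F 0 x) :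
    IsCM f ↔ ∀ (n : ℕ) (x : ℝ), 0 < x → 0 ≤ (-1 : ℝ) ^ n * F n x := by
  have hit : ∀ (n : ℕ) (x : ℝ), 0 < x → iteratedDeriv n f x = F n x := by
    intro n
    induction n with
    | zero => simpa using hf
    | succ n ih =>
      intro x hx
      rw [iteratedDeriv_succ]
      have : iteratedDeriv n f =ᶠ[𝓝 x] F n := by
        filter_upwards [Ioi_mem_nhds hx] with y hy using ih y hy
      rw [this.deriv_eq, (hF n x hx).deriv]
  have hsmooth : ∀ (k n : ℕ), ContDiffOn ℝ k (F n) (Ioi 0) := by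
    intro k
    induction k with
    | zero =>
      intro n
      exact contDiffOn_zero.2 fun x hx => (hF n x hx).continuousAt.continuousWithinAt
    | succ k ih =>
      intro n
      push_cast
      rw [contDiffOn_succ_iff_deriv_of_isOpen isOpen_Ioi]
      refine ⟨fun x hx => (hF n x hx).differentiableAt.differentiableWithinAt, by simp, ?_⟩
      exact (ih (n + 1)).congr fun x hx => (hF n x hx).deriv
  have hcd : ContDiffOn ℝ ∞ f (Ioi 0) :=
    (contDiffOn_infty.2 fun k => hsmooth k 0).congr fun x hx => hf x hx
  refine ⟨fun h n x hx => hit n x hx ▸ h.2 n x hx, fun h => ⟨hcd, fun n x hx => ?_⟩⟩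
  rw [hit n x hx]
  exact h n x hx

theorem integrableOn_pow_mul_exp_neg_mul_mul {q : ℝ → ℝ} {M : ℝ}
    (hq : ContinuousOn q (Ioi 0)) (hM : ∀ s, 0 < s → |q s| ≤ M) (n : ℕ) {x : ℝ} (hx : 0 < x) :
    IntegrableOn (fun s : ℝ => s ^ n * Real.exp (-(x * s)) * q s) (Ioi 0) := by
  refine Integrable.mul_bdd (c := M) (integrableOn_pow_mul_exp_neg_mul n hx)
    (hq.aestronglyMeasurable measurableSet_Ioi) ?_
  filter_upwards [ae_restrict_mem measurableSet_Ioi] with s hs using hM s hs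

theorem hasDerivAt_laplace {q : ℝ → ℝ} {M : ℝ}
    (hq : ContinuousOn q (Ioi 0)) (hM : ∀ s, 0 < s → |q s| ≤ M) (n : ℕ) {x : ℝ} (hx : 0 < x) :
    HasDerivAt (fun x => ∫ s in Ioi (0 : ℝ), (-1) ^ n * (s ^ n * Real.exp (-(x * s)) * q s))
      (∫ s in Ioi (0 : ℝ), (-1) ^ (n + 1) * (s ^ (n + 1) * Real.exp (-(x * s)) * q s)) x := by
  have hint := fun (n : ℕ) {x : ℝ} (hx : 0 < x) =>
    (integrableOn_pow_mul_exp_neg_mul_mul hq hM n hx).const_mul ((-1) ^ n)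
  refine (hasDerivAt_integral_of_dominated_loc_of_deriv_le (μ := volume.restrict (Ioi 0))
    -- Restricting to parameters `y > x/2` makes `e^{-(x/2)s}` a common majorant.
    (bound := fun s => s ^ (n + 1) * Real.exp (-(x / 2 * s)) * M)
    (F' := fun x s => (-1) ^ (n + 1) * (s ^ (n + 1) * Real.exp (-(x * s)) * q s))
    (Ioi_mem_nhds (half_lt_self hx)) ?_ (hint n hx) (hint (n + 1) hx).aestronglyMeasurable
    ?_ ((integrableOn_pow_mul_exp_neg_mul (n + 1) (half_pos hx)).mul_const M) ?_).2
  · filter_upwards [Ioi_mem_nhds hx] with y hy using (hint n hy).aestronglyMeasurable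
  · filter_upwards [ae_restrict_mem measurableSet_Ioi] with s hs y hy
    have hs : 0 < s := hs
    have hy : x / 2 < y := hy
    rw [norm_mul, norm_pow, norm_neg, norm_one, one_pow, one_mul, norm_mul, norm_mul, norm_pow,
      Real.norm_of_nonneg hs.le, Real.norm_of_nonneg (Real.exp_pos _).le, Real.norm_eq_abs]
    have h1 : Real.exp (-(y * s)) ≤ Real.exp (-(x / 2 * s)) :=
      Real.exp_le_exp.2 (by nlinarith)
    have h2 := hM s hs
    have h3 := abs_nonneg (q s)
    gcongr
  · refine Eventually.of_forall fun s y _ => ?_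
    have h : HasDerivAt (fun y : ℝ => Real.exp (-(y * s))) (Real.exp (-(y * s)) * -s) y := by
      have := (((hasDerivAt_id y).mul_const s).neg).exp
      simpa using this
    have := ((h.const_mul (s ^ n)).mul_const (q s)).const_mul ((-1) ^ n)
    convert! this using 1
    ring

/-- This is a Post–Widder argument: with `x = (n + 1)/s₀`, the normalized weight `sⁿ e^{-xs}` is a
gamma law with mean `s₀` and variance `s₀²/(n + 1)`. If `q s₀ < 0`, a quadratic majorant of `q`
gives a negative moment for large `n`. -/
theorem nonneg_of_laplace_moments_nonneg {q : ℝ → ℝ} {M : ℝ}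
    (hq : ContinuousOn q (Ioi 0)) (hM : ∀ s, 0 < s → |q s| ≤ M)
    (h : ∀ (n : ℕ) (x : ℝ), 0 < x →
      0 ≤ ∫ s in Ioi (0 : ℝ), s ^ n * Real.exp (-(x * s)) * q s) {s₀ : ℝ} (hs₀ : 0 < s₀) :
    0 ≤ q s₀ := by
  by_contra! hneg
  set m := -q s₀ / 2 with hm
  have hm0 : 0 < m := by rw [hm]; linarith
  have hcont : ContinuousAt q s₀ := (hq s₀ hs₀).continuousAt (Ioi_mem_nhds hs₀)
  obtain ⟨δ, hδ, hball⟩ := Metric.eventually_nhds_iff.1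
    (hcont.eventually (gt_mem_nhds (show q s₀ < -m by rw [hm]; linarith)))
  have hM0 : 0 ≤ M := (abs_nonneg _).trans (hM s₀ hs₀)
  -- `C` is such that `C (s - s₀)²` reaches `M + m` at distance `δ`, which covers all `s` outside
  -- the ball where `q < -m`.
  set C := (M + m) / δ ^ 2 with hC
  have hC0 : 0 ≤ C := by rw [hC]; positivity
  have hle : ∀ s, 0 < s → q s ≤ -m + C * (s - s₀) ^ 2 := by
    intro s hs
    rcases lt_or_ge (dist s s₀) δ with hd | hd
    · have := hball hd
      have : 0 ≤ C * (s - s₀) ^ 2 := by positivity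
      linarith
    · have h1 : δ ^ 2 ≤ (s - s₀) ^ 2 := by
        rw [← sq_abs (s - s₀), ← Real.dist_eq]
        gcongr
      have h2 : M + m ≤ C * (s - s₀) ^ 2 := by
        calc M + m = C * δ ^ 2 := by rw [hC]; field_simp
          _ ≤ C * (s - s₀) ^ 2 := by gcongr
      linarith [(le_abs_self _).trans (hM s hs)]
  obtain ⟨n, hn⟩ := exists_nat_gt (C * s₀ ^ 2 / m)
  have hn1 : (0 : ℝ) < n + 1 := by positivity
  set x := ((n : ℝ) + 1) / s₀ with hx
  have hx0 : 0 < x := by rw [hx]; positivity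
  set J := fun k : ℕ => ∫ s in Ioi (0 : ℝ), s ^ k * Real.exp (-(x * s)) with hJ
  have hi := fun k : ℕ => integrableOn_pow_mul_exp_neg_mul k hx0
  have hJpos : 0 < J n := by
    simp only [hJ, integral_pow_mul_exp_neg_mul n hx0]
    positivity
  have hrec : ∀ k : ℕ, J (k + 1) = (k + 1) / x * J k := by
    intro k
    simp only [hJ, integral_pow_mul_exp_neg_mul _ hx0, Nat.factorial_succ]
    push_cast
    clear_value x
    field_simp
    ring
  have hJ1 : J (n + 1) = s₀ * J n := by
    rw [hrec, hx]
    field_simp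
  have hJ2 : J (n + 2) = s₀ ^ 2 * (n + 2) / (n + 1) * J n := by
    rw [hrec, hJ1, hx]
    push_cast
    field_simp
    ring
  have hsplit : (∫ s in Ioi (0 : ℝ), (((C * (s ^ (n + 2) * Real.exp (-(x * s))) -
      2 * C * s₀ * (s ^ (n + 1) * Real.exp (-(x * s)))) +
      (C * s₀ ^ 2 - m) * (s ^ n * Real.exp (-(x * s)))))) =
      C * J (n + 2) - 2 * C * s₀ * J (n + 1) + (C * s₀ ^ 2 - m) * J n := by
    have h1 : IntegrableOn (fun s : ℝ => C * (s ^ (n + 2) * Real.exp (-(x * s))) -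
        2 * C * s₀ * (s ^ (n + 1) * Real.exp (-(x * s)))) (Ioi 0) :=
      ((hi _).const_mul _).sub ((hi _).const_mul _)
    rw [integral_add h1 ((hi _).const_mul _), integral_sub ((hi _).const_mul _) ((hi _).const_mul _), integral_const_mul,
      integral_const_mul, integral_const_mul]
  have hub : (∫ s in Ioi (0 : ℝ), s ^ n * Real.exp (-(x * s)) * q s) ≤
      C * J (n + 2) - 2 * C * s₀ * J (n + 1) + (C * s₀ ^ 2 - m) * J n := by
    rw [← hsplit]
    refine setIntegral_mono_on (integrableOn_pow_mul_exp_neg_mul_mul hq hM n hx0)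
      ((((hi _).const_mul _).sub ((hi _).const_mul _)).add ((hi _).const_mul _))
      measurableSet_Ioi fun s hs => ?_
    have hs : 0 < s := hs
    have h1 := mul_le_mul_of_nonneg_left (hle s hs)
      (by positivity : 0 ≤ s ^ n * Real.exp (-(x * s)))
    refine h1.trans (le_of_eq ?_)
    ring
  -- The terms with `C` combine to `C` times the variance `s₀²/(n + 1)`, which the choice of `n`
  -- makes smaller than `m`.
  have hval : C * J (n + 2) - 2 * C * s₀ * J (n + 1) + (C * s₀ ^ 2 - m) * J n =
      (C * s₀ ^ 2 / (n + 1) - m) * J n := by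
    rw [hJ1, hJ2]
    field_simp
    ring
  have hlt : C * s₀ ^ 2 / (n + 1) - m < 0 := by
    rw [div_lt_iff₀ hm0] at hn
    rw [sub_neg, div_lt_iff₀ hn1]
    nlinarith
  have := h n x hx0
  nlinarith

theorem isCM_laplace_iff {f q : ℝ → ℝ} {M : ℝ}
    (hq : ContinuousOn q (Ioi 0)) (hM : ∀ s, 0 < s → |q s| ≤ M)
    (hf : ∀ x, 0 < x → f x = ∫ s in Ioi (0 : ℝ), Real.exp (-(x * s)) * q s) :
    IsCM f ↔ ∀ s, 0 < s → 0 ≤ q s := by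
  rw [isCM_of_hasDerivAt (F := fun n x =>
    ∫ s in Ioi (0 : ℝ), (-1) ^ n * (s ^ n * Real.exp (-(x * s)) * q s))
    (fun n x hx => hasDerivAt_laplace hq hM n hx) (fun x hx => by simpa using hf x hx)]
  have hsign : ∀ (n : ℕ) (a : ℝ), (-1 : ℝ) ^ n * ((-1) ^ n * a) = a := by
    intro n a
    rw [← mul_assoc, ← mul_pow]
    norm_num
  simp_rw [integral_const_mul, hsign]
  refine ⟨fun h s hs => nonneg_of_laplace_moments_nonneg hq hM h hs, fun h n x _ => ?_⟩
  refine setIntegral_nonneg measurableSet_Ioi fun s hs => ?_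
  have hs' : 0 < s := hs
  have := h s hs
  positivity

/-! ### Stieltjes integrals over `(0,1)` as Laplace transforms -/

/-- Fubini applied to `1/(x + t) = ∫ e^{-(x + t)s} ds`. -/
theorem integral_div_add_eq_laplace {κ : ℝ → ℝ} (hκ : IntervalIntegrable κ volume 0 1) {x : ℝ}
    (hx : 0 < x) :
    (∫ t in (0 : ℝ)..1, κ t / (x + t)) =
      ∫ s in Ioi (0 : ℝ), Real.exp (-(x * s)) *
        ∫ t in (0 : ℝ)..1, Real.exp (-(t * s)) * κ t := by
  have hexp : ∀ {c : ℝ}, 0 < c → (∫ s in Ioi (0 : ℝ), Real.exp (-(c * s))) = 1 / c := by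
    intro c hc
    simpa using integral_pow_mul_exp_neg_mul 0 hc
  simp_rw [intervalIntegral.integral_of_le zero_le_one, ← integral_const_mul]
  have hκ' : IntegrableOn κ (Ioc 0 1) := (intervalIntegrable_iff_integrableOn_Ioc_of_le zero_le_one).1 hκ
  have hprod : Integrable (Function.uncurry fun t s : ℝ =>
      Real.exp (-(x * s)) * (Real.exp (-(t * s)) * κ t))
      ((volume.restrict (Ioc 0 1)).prod (volume.restrict (Ioi 0))) := by
    have h0 : IntegrableOn (fun s : ℝ => Real.exp (-(x * s))) (Ioi 0) := by
      simpa using integrableOn_pow_mul_exp_neg_mul 0 hx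
    have h1 := Integrable.mul_prod hκ' h0
    have h2 := Integrable.bdd_mul (f := fun z : ℝ × ℝ => Real.exp (-(z.1 * z.2))) (c := 1) h1
      (by fun_prop) (by
        rw [Measure.prod_restrict]
        filter_upwards [ae_restrict_mem (measurableSet_Ioc.prod measurableSet_Ioi)] with z hz
        rw [Real.norm_of_nonneg (Real.exp_pos _).le, Real.exp_le_one_iff]
        have h1 : 0 < z.1 := hz.1.1
        have h2 : 0 < z.2 := hz.2
        have := mul_pos h1 h2
        linarith)
    refine h2.congr (Eventually.of_forall fun z => ?_)
    simp only [Function.uncurry]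
    ring
  rw [← integral_integral_swap hprod]
  refine setIntegral_congr_fun measurableSet_Ioc fun t ht => ?_
  have ht0 : 0 < x + t := by linarith [ht.1]
  have : ∀ s : ℝ, Real.exp (-(x * s)) * (Real.exp (-(t * s)) * κ t) =
      Real.exp (-((x + t) * s)) * κ t := by
    intro s
    rw [← mul_assoc, ← Real.exp_add]
    ring_nf
  simp_rw [this]
  rw [integral_mul_const, hexp ht0]
  ring

theorem abs_integral_exp_neg_mul_le {κ : ℝ → ℝ} (hκ : IntervalIntegrable κ volume 0 1) {s : ℝ}
    (hs : 0 < s) :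
    |∫ t in (0 : ℝ)..1, Real.exp (-(t * s)) * κ t| ≤ ∫ t in (0 : ℝ)..1, |κ t| := by
  rw [← Real.norm_eq_abs]
  refine intervalIntegral.norm_integral_le_of_norm_le zero_le_one
    (Eventually.of_forall fun t ht => ?_) hκ.abs
  rw [norm_mul, Real.norm_of_nonneg (Real.exp_pos _).le, Real.norm_eq_abs]
  refine mul_le_of_le_one_left (abs_nonneg _) (Real.exp_le_one_iff.2 ?_)
  have := mul_pos ht.1 hs
  linarith

theorem continuousOn_integral_exp_neg_mul {κ : ℝ → ℝ} (hκ : IntervalIntegrable κ volume 0 1) :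
    ContinuousOn (fun s => ∫ t in (0 : ℝ)..1, Real.exp (-(t * s)) * κ t) (Ioi 0) := by
  intro s hs
  have hκ' : AEStronglyMeasurable κ (volume.restrict (uIoc 0 1)) :=
    hκ.def'.aestronglyMeasurable
  refine (intervalIntegral.continuousAt_of_dominated_interval (bound := fun t => |κ t|)
    ?_ ?_ hκ.abs ?_).continuousWithinAt
  · exact Eventually.of_forall fun s =>
      AEStronglyMeasurable.mul (by fun_prop) hκ'
  · filter_upwards [Ioi_mem_nhds hs] with s' hs'
    refine Eventually.of_forall fun t ht => ?_
    rw [uIoc_of_le zero_le_one] at ht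
    rw [norm_mul, Real.norm_of_nonneg (Real.exp_pos _).le, Real.norm_eq_abs]
    refine mul_le_of_le_one_left (abs_nonneg _) (Real.exp_le_one_iff.2 ?_)
    have := mul_pos ht.1 (mem_Ioi.1 hs')
    linarith
  · exact Eventually.of_forall fun t _ => by fun_prop

/-! ### `gFun` is a Stieltjes function -/

/-- The Stieltjes measure of `gFun`. -/
noncomputable def gMeasure : Measure ℝ :=
  Measure.dirac 1 + (volume.restrict (Ioo 0 1)).withDensity fun t => ((gDensity t).toNNReal : ENNReal)

theorem integrableOn_gDensity : IntegrableOn gDensity (Ioo 0 1) :=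
  (intervalIntegrable_iff_integrableOn_Ioo_of_le zero_le_one).1 intervalIntegrable_gDensity

instance isFiniteMeasure_gMeasure : IsFiniteMeasure gMeasure := by
  have : IsFiniteMeasure ((volume.restrict (Ioo (0 : ℝ) 1)).withDensity
      fun t => ((gDensity t).toNNReal : ENNReal)) :=
    isFiniteMeasure_withDensity_ofReal integrableOn_gDensity.2
  unfold gMeasure
  infer_instance

theorem gMeasure_Iio_zero : gMeasure (Iio 0) = 0 := by
  have h : (volume.restrict (Ioo (0 : ℝ) 1)) (Iio 0) = 0 := by
    rw [Measure.restrict_apply measurableSet_Iio]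
    have : Iio (0 : ℝ) ∩ Ioo 0 1 = ∅ := by
      ext t
      simp only [mem_inter_iff, mem_Iio, mem_Ioo, mem_empty_iff_false, iff_false]
      rintro ⟨h1, h2, _⟩
      linarith
    rw [this, measure_empty]
  rw [gMeasure, Measure.add_apply, withDensity_absolutelyContinuous _ _ h, add_zero,
    Measure.dirac_apply' _ measurableSet_Iio]
  norm_num

theorem isStieltjes_gFun : IsStieltjes gFun := by
  -- The constant is `0`; the atom of `gMeasure` at `1` supplies the term `1/(1 + x)`.
  refine ⟨0, gMeasure, le_rfl, inferInstance, gMeasure_Iio_zero, fun x hx => ?_⟩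
  have hmeas : Measurable fun t => (gDensity t).toNNReal := measurable_gDensity.real_toNNReal
  have hdens : ∀ t ∈ Ioo (0 : ℝ) 1,
      (gDensity t).toNNReal • (1 / (t + x)) = gDensity t / (x + t) := by
    intro t ht
    rw [NNReal.smul_def, Real.coe_toNNReal _ (gDensity_pos ht).le, smul_eq_mul, add_comm t x]
    ring
  have h1 : Integrable (fun t : ℝ => 1 / (t + x)) (Measure.dirac 1) :=
    integrable_dirac (by finiteness)
  have h2 : Integrable (fun t : ℝ => 1 / (t + x)) ((volume.restrict (Ioo 0 1)).withDensity
      fun t => ((gDensity t).toNNReal : ENNReal)) := by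
    rw [integrable_withDensity_iff_integrable_smul hmeas]
    refine IntegrableOn.congr_fun (f := fun t => gDensity t / (x + t)) ?_
      (fun t ht => (hdens t ht).symm) measurableSet_Ioo
    exact (intervalIntegrable_iff_integrableOn_Ioo_of_le zero_le_one).1
      (intervalIntegrable_gDensity_div hx)
  refine ⟨h1.add_measure h2, ?_⟩
  rw [gMeasure, integral_add_measure h1 h2, integral_dirac,
    integral_withDensity_eq_integral_smul hmeas, setIntegral_congr_fun measurableSet_Ioo hdens,
    gFun_eq_integral hx, intervalIntegral.integral_of_le zero_le_one, integral_Ioc_eq_integral_Ioo,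
    zero_add]

/-! ### The logarithmic derivative of `h_a'` -/

theorem hFun_eq_exp {a x : ℝ} (hx : 0 < x) :
    hFun a x = Real.exp (Real.log (1 + 1 / x) * (a * x)) :=
  Real.rpow_def_of_pos (by positivity) _

theorem hasDerivAt_hFun (a : ℝ) {x : ℝ} (hx : 0 < x) :
    HasDerivAt (hFun a) (a * hFun a x * rho x) x := by
  have hx' := hx.ne'
  have h1 : HasDerivAt (fun y : ℝ => 1 + 1 / y) (-(1 / x ^ 2)) x := by
    have := (hasDerivAt_inv hx').const_add 1
    simpa using this
  have hpos : 1 + 1 / x ≠ 0 := by positivity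
  have h2 := ((h1.log hpos).mul ((hasDerivAt_id x).const_mul a)).exp
  have h3 : HasDerivAt (hFun a) _ x := h2.congr_of_eventuallyEq (by
    filter_upwards [Ioi_mem_nhds hx] with y hy using hFun_eq_exp hy)
  convert! h3 using 1
  rw [hFun_eq_exp hx, rho]
  have : 1 + x ≠ 0 := by positivity
  simp only [Pi.mul_apply, id]
  have e : 1 + 1 / x = (1 + x) / x := by field_simp; ring
  generalize Real.log (1 + 1 / x) = l
  rw [e]
  field_simp
  ring

theorem contDiffOn_hFun (a : ℝ) : ContDiffOn ℝ ∞ (hFun a) (Ioi 0) := by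
  have h1 : ContDiffOn ℝ ∞ (fun x : ℝ => 1 + 1 / x) (Ioi 0) :=
    contDiffOn_const.add (contDiffOn_const.div contDiffOn_id fun x hx => (mem_Ioi.1 hx).ne')
  have h2 : ContDiffOn ℝ ∞ (fun x : ℝ => Real.log (1 + 1 / x)) (Ioi 0) :=
    h1.log fun x hx => by
      have : 0 < x := hx
      positivity
  exact ((h2.mul (contDiffOn_const.mul contDiffOn_id)).exp).congr fun x hx => hFun_eq_exp hx

theorem deriv_hFun_pos {a x : ℝ} (ha : 0 < a) (hx : 0 < x) : 0 < deriv (hFun a) x := by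
  have h1 := rho_pos hx
  have h2 : 0 < hFun a x := hFun_eq_exp hx ▸ Real.exp_pos _
  rw [(hasDerivAt_hFun a hx).deriv]
  positivity

theorem neg_logDeriv_deriv_hFun {a x : ℝ} (ha : 0 < a) (hx : 0 < x) :
    -deriv (deriv (hFun a)) x / deriv (hFun a) x = gFun x - a * rho x := by
  have h : deriv (hFun a) =ᶠ[𝓝 x] fun y => a * hFun a y * rho y := by
    filter_upwards [Ioi_mem_nhds hx] with y hy using (hasDerivAt_hFun a hy).deriv
  have hd := (((hasDerivAt_hFun a hx).const_mul a).mul (hasDerivAt_rho hx)).deriv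
  have h1 := (rho_pos hx).ne'
  have h2 : hFun a x ≠ 0 := hFun_eq_exp hx ▸ (Real.exp_pos _).ne'
  have h3 := ha.ne'
  rw [h.deriv_eq, (hasDerivAt_hFun a hx).deriv, gFun, (hasDerivAt_rho hx).deriv]
  refine (congrArg (fun d => -d / (a * hFun a x * rho x)) hd).trans ?_
  field_simp
  ring

theorem isLCM_deriv_hFun_iff {a : ℝ} (ha : 0 < a) :
    IsLCM (deriv (hFun a)) ↔
      IsCM (fun x => -deriv (deriv (hFun a)) x / deriv (hFun a) x) := by
  refine ⟨fun h => h.2.2, fun h => ⟨?_, fun x hx => deriv_hFun_pos ha hx, h⟩⟩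
  exact ((contDiffOn_infty_iff_deriv_of_isOpen isOpen_Ioi).1 (contDiffOn_hFun a)).2

/-- The atom at `1` enters here with a negative sign, so in `g - a ρ` its weight becomes `1 + a`. -/
theorem rho_eq_integral {x : ℝ} (hx : 0 < x) :
    rho x = (∫ t in (0 : ℝ)..1, 1 / (x + t)) - 1 / (1 + x) := by
  have h : (∫ t in (0 : ℝ)..1, 1 / (x + t)) = Real.log (1 + 1 / x) := by
    have h1 := intervalIntegral.integral_comp_add_left (a := 0) (b := 1) (fun t : ℝ => t⁻¹) x
    rw [integral_inv_of_pos (by linarith) (by linarith)] at h1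
    simp_rw [one_div]
    rw [h1]
    congr 1
    field_simp
    ring
  rw [h, rho]

theorem gFun_sub_mul_rho_eq (a : ℝ) {x : ℝ} (hx : 0 < x) :
    gFun x - a * rho x =
      (1 + a) / (1 + x) + ∫ t in (0 : ℝ)..1, (gDensity t - a) / (x + t) := by
  have hi : IntervalIntegrable (fun t : ℝ => 1 / (x + t)) volume 0 1 := by
    refine ContinuousOn.intervalIntegrable ?_
    rw [uIcc_of_le zero_le_one]
    refine ContinuousOn.div (by fun_prop) (by fun_prop) fun t ht => ?_
    have := ht.1
    positivity
  have hs : (∫ t in (0 : ℝ)..1, (gDensity t - a) / (x + t)) =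
      (∫ t in (0 : ℝ)..1, gDensity t / (x + t)) - a * ∫ t in (0 : ℝ)..1, 1 / (x + t) := by
    rw [← intervalIntegral.integral_const_mul,
      ← intervalIntegral.integral_sub (intervalIntegrable_gDensity_div hx) (hi.const_mul a)]
    refine intervalIntegral.integral_congr fun t _ => ?_
    ring
  rw [hs, gFun_eq_integral hx, rho_eq_integral hx]
  ring

/-- The density whose Laplace transform is `gFun - a * rho`. -/
noncomputable def laplaceDensity (a s : ℝ) : ℝ :=
  (1 + a) * Real.exp (-s) + ∫ t in (0 : ℝ)..1, Real.exp (-(t * s)) * (gDensity t - a)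

theorem intervalIntegrable_gDensity_sub (a : ℝ) :
    IntervalIntegrable (fun t => gDensity t - a) volume 0 1 :=
  intervalIntegrable_gDensity.sub intervalIntegrable_const

theorem continuousOn_laplaceDensity (a : ℝ) : ContinuousOn (laplaceDensity a) (Ioi 0) := by
  unfold laplaceDensity
  exact ContinuousOn.add (by fun_prop)
    (continuousOn_integral_exp_neg_mul (intervalIntegrable_gDensity_sub a))

theorem abs_laplaceDensity_le {a s : ℝ} (ha : 0 < a) (hs : 0 < s) :
    |laplaceDensity a s| ≤ 1 + a + ∫ t in (0 : ℝ)..1, |gDensity t - a| := by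
  refine (abs_add_le _ _).trans (add_le_add ?_
    (abs_integral_exp_neg_mul_le (intervalIntegrable_gDensity_sub a) hs))
  rw [abs_of_nonneg (by positivity)]
  exact mul_le_of_le_one_right (by positivity) (Real.exp_le_one_iff.2 (by linarith))

theorem gFun_sub_mul_rho_eq_laplace {a x : ℝ} (hx : 0 < x) :
    gFun x - a * rho x = ∫ s in Ioi (0 : ℝ), Real.exp (-(x * s)) * laplaceDensity a s := by
  have hx1 : 0 < 1 + x := by positivity
  have hκ := intervalIntegrable_gDensity_sub a
  have e : ∀ s : ℝ, Real.exp (-(x * s)) * laplaceDensity a s =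
      (1 + a) * (s ^ 0 * Real.exp (-((1 + x) * s))) + s ^ 0 * Real.exp (-(x * s)) *
        ∫ t in (0 : ℝ)..1, Real.exp (-(t * s)) * (gDensity t - a) := by
    intro s
    rw [laplaceDensity, show -((1 + x) * s) = -(x * s) + -s by ring, Real.exp_add]
    ring
  simp_rw [e]
  rw [integral_add ((integrableOn_pow_mul_exp_neg_mul 0 hx1).const_mul _)
    (integrableOn_pow_mul_exp_neg_mul_mul (continuousOn_integral_exp_neg_mul hκ)
      (fun s hs => abs_integral_exp_neg_mul_le hκ hs) 0 hx), integral_const_mul,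
    integral_pow_mul_exp_neg_mul 0 hx1, gFun_sub_mul_rho_eq a hx, integral_div_add_eq_laplace hκ hx]
  simp [div_eq_mul_inv]

theorem isLCM_deriv_hFun_iff_laplaceDensity_nonneg {a : ℝ} (ha : 0 < a) :
    IsLCM (deriv (hFun a)) ↔ ∀ s, 0 < s → 0 ≤ laplaceDensity a s := by
  rw [isLCM_deriv_hFun_iff ha]
  exact isCM_laplace_iff (continuousOn_laplaceDensity a) (fun s hs => abs_laplaceDensity_le ha hs)
    fun x hx => (neg_logDeriv_deriv_hFun ha hx).trans (gFun_sub_mul_rho_eq_laplace hx)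

/-! ### The power series -/

/-- The exponential series is integrated termwise against `τ (1 - r) - a`, with `e^{|s|} |τ (1 - r)
- a|` dominating the sum. -/
theorem hasSum_seriesTerm {τ : ℝ → ℝ} (hτ : IntervalIntegrable τ volume 0 1) (a s : ℝ) :
    HasSum (seriesTerm τ a s) (∫ r in (0 : ℝ)..1, Real.exp (r * s) * (τ (1 - r) - a)) := by
  have hτ' : IntervalIntegrable (fun r => τ (1 - r)) volume 0 1 := by
    have := (hτ.comp_sub_left 1).symm
    simpa using this
  have hκ : IntervalIntegrable (fun r => τ (1 - r) - a) volume 0 1 :=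
    hτ'.sub intervalIntegrable_const
  have hterm : ∀ n : ℕ, seriesTerm τ a s n =
      ∫ r in (0 : ℝ)..1, s ^ n / (n ! : ℝ) * (r ^ n * (τ (1 - r) - a)) := by
    intro n
    have h1 : (∫ r in (0 : ℝ)..1, r ^ n * (τ (1 - r) - a)) = moment τ n - a / (n + 1) := by
      have h2 : IntervalIntegrable (fun r => r ^ n * τ (1 - r)) volume 0 1 :=
        hτ'.continuousOn_mul (by fun_prop)
      have h3 : IntervalIntegrable (fun r : ℝ => a * r ^ n) volume 0 1 :=
        Continuous.intervalIntegrable (by fun_prop) _ _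
      have h4 : (∫ r in (0 : ℝ)..1, a * r ^ n) = a / (n + 1) := by
        rw [intervalIntegral.integral_const_mul, integral_pow]
        simp [div_eq_mul_inv]
      rw [moment, ← h4, ← intervalIntegral.integral_sub h2 h3]
      refine intervalIntegral.integral_congr fun r _ => ?_
      ring
    rw [intervalIntegral.integral_const_mul, h1, seriesTerm]
    ring
  have hsum : HasSum (fun n => ∫ r in (0 : ℝ)..1, s ^ n / (n ! : ℝ) * (r ^ n * (τ (1 - r) - a)))
      (∫ r in (0 : ℝ)..1, Real.exp (r * s) * (τ (1 - r) - a)) := by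
    have hexp : ∀ y : ℝ, HasSum (fun n : ℕ => y ^ n / (n ! : ℝ)) (Real.exp y) := by
      intro y
      rw [Real.exp_eq_exp_ℝ]
      exact NormedSpace.expSeries_div_hasSum_exp y
    have hb := fun r : ℝ => (hexp |s|).mul_right |τ (1 - r) - a|
    refine intervalIntegral.hasSum_integral_of_dominated_convergence
      (fun n r => |s| ^ n / (n ! : ℝ) * |τ (1 - r) - a|) ?_ ?_ ?_ ?_ ?_
    · intro n
      exact ((hκ.continuousOn_mul (g := fun r => r ^ n)
        (by fun_prop)).const_mul _).def'.aestronglyMeasurable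
    · intro n
      refine Eventually.of_forall fun r hr => ?_
      rw [uIoc_of_le zero_le_one] at hr
      rw [norm_mul, norm_div, norm_pow, norm_mul, norm_pow, Real.norm_eq_abs, Real.norm_eq_abs,
        Real.norm_eq_abs, Real.norm_eq_abs, abs_of_pos hr.1, Nat.abs_cast]
      refine mul_le_mul_of_nonneg_left ?_ (by positivity)
      exact mul_le_of_le_one_left (abs_nonneg _) (pow_le_one₀ hr.1.le hr.2)
    · exact Eventually.of_forall fun r _ => (hb r).summable
    · simp_rw [fun r => (hb r).tsum_eq]
      exact hκ.abs.const_mul _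
    · refine Eventually.of_forall fun r _ => ?_
      refine ((hexp (r * s)).mul_right _).congr_fun fun n => ?_
      rw [mul_pow]
      ring
  exact hsum.congr_fun hterm

/-- The reflection `t = 1 - r` extracts `e⁻ˢ`. The constant term of the series is `1 - a` because
`τ` has mass one, and with the atom's `1 + a` it makes the `2`. -/
theorem laplaceDensity_eq (a s : ℝ) :
    laplaceDensity a s =
      Real.exp (-s) * (2 + ∑' k : ℕ, seriesTerm gDensity a s (k + 1)) := by
  have h := hasSum_seriesTerm intervalIntegrable_gDensity a s
  have h0 : seriesTerm gDensity a s 0 = 1 - a := by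
    have := intervalIntegral.integral_comp_sub_left (a := 0) (b := 1) gDensity 1
    simp only [sub_self, sub_zero, integral_gDensity] at this
    simp [seriesTerm, moment, this]
  have h1 : (2 : ℝ) + ∑' k : ℕ, seriesTerm gDensity a s (k + 1) =
      1 + a + ∫ r in (0 : ℝ)..1, Real.exp (r * s) * (gDensity (1 - r) - a) := by
    rw [← h.tsum_eq, h.summable.tsum_eq_zero_add, h0]
    ring
  have h2 : (∫ t in (0 : ℝ)..1, Real.exp (-(t * s)) * (gDensity t - a)) =
      Real.exp (-s) * ∫ r in (0 : ℝ)..1, Real.exp (r * s) * (gDensity (1 - r) - a) := by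
    have := intervalIntegral.integral_comp_sub_left (a := 0) (b := 1)
      (fun t => Real.exp (-(t * s)) * (gDensity t - a)) 1
    simp only [sub_self, sub_zero] at this
    rw [← this, ← intervalIntegral.integral_const_mul]
    refine intervalIntegral.integral_congr fun r _ => ?_
    rw [← mul_assoc, ← Real.exp_add]
    ring_nf
  rw [laplaceDensity, h1, h2]
  ring

theorem mainTheorem3 :
    IsStieltjes gFun ∧
    ∃ (G : ℂ → ℂ) (τ : ℝ → ℝ),
      -- `G` is the holomorphic extension of `g` to the plane cut along `(-∞, 0]`
      DifferentiableOn ℂ G Complex.slitPlane ∧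
      (∀ x : ℝ, 0 < x → G (x : ℂ) = (gFun x : ℂ)) ∧
      -- `τ` is positive and given by the boundary values of `G` on the cut
      (∀ t ∈ Ioo (0 : ℝ) 1, 0 < τ t ∧
        Tendsto (fun y : ℝ => -(1 / Real.pi) * (G ((-t : ℂ) + (y : ℂ) * Complex.I)).im)
          (𝓝[>] (0 : ℝ)) (𝓝 (τ t))) ∧
      -- `τ` has total mass one
      IntervalIntegrable τ volume 0 1 ∧
      (∫ t in (0 : ℝ)..1, τ t) = 1 ∧
      -- the integral representation
      (∀ x : ℝ, 0 < x →
        gFun x = 1 / (1 + x) + ∫ t in (0 : ℝ)..1, τ t / (x + t)) ∧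
      -- the characterization of `h_a' ∈ LCM`; the sum runs over `n = k + 1 ≥ 1`
      (∀ a : ℝ, 0 < a →
        (∀ t : ℝ, 0 ≤ t → Summable (fun k : ℕ => seriesTerm τ a t (k + 1))) ∧
        (IsLCM (deriv (hFun a)) ↔
          ∀ t : ℝ, 0 ≤ t → 0 ≤ 2 + ∑' k : ℕ, seriesTerm τ a t (k + 1))) := by
  refine ⟨isStieltjes_gFun, gExt, gDensity, differentiableOn_gExt, fun x hx => gExt_ofReal hx,
    fun t ht => ⟨gDensity_pos ht, tendsto_im_gExt ht⟩, intervalIntegrable_gDensity,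
    integral_gDensity, fun x hx => gFun_eq_integral hx, fun a ha => ⟨fun t _ => ?_, ?_⟩⟩
  · exact (summable_nat_add_iff 1).2 (hasSum_seriesTerm intervalIntegrable_gDensity a t).summable
  · rw [isLCM_deriv_hFun_iff_laplaceDensity_nonneg ha]
    have hiff : ∀ s : ℝ, 0 ≤ laplaceDensity a s ↔
        0 ≤ 2 + ∑' k : ℕ, seriesTerm gDensity a s (k + 1) := fun s => by
      rw [laplaceDensity_eq, mul_nonneg_iff_of_pos_left (Real.exp_pos _)]
    simp_rw [hiff]
    refine ⟨fun h t ht => ?_, fun h s hs => h s hs.le⟩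
    -- The Laplace criterion says nothing at `t = 0`, but there every term with `n ≥ 1` vanishes and
    -- the value is `2`.
    rcases ht.eq_or_lt with rfl | ht
    · simp [seriesTerm]
    · exact h t ht
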